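/- Let $K\ge 0$ and let $\mathcal X,\mathcal W,\mathcal Y_k,\mathcal V_k,\mathcal U_k$ ($1\le k\le K$) be finite alphabets. Let $(X,Y_1,\dots,Y_K,V_1,\dots,V_K)$ have an arbitrary joint pmf, and let $T(u_1,\dots,u_K\mid w)$ be a broadcast channel (a conditional pmf on $\mathcal U_1\times\dots\times\mathcal U_K$ given $w\in\mathcal W$). Fix a rational $\kappa>0$ and $\boldsymbol R=(R_1,\dots,R_K)\in\mathbb R^K$. All entropies and mutual informations are in bits. Let $(\mathbf X,\mathbf Y_1,\dots,\mathbf Y_K,\mathbf V_1,\dots,\mathbf V_K)$ consist of $n_{\rm s}$ i.i.d. copies of $(X,Y_1,\dots,Y_K,V_1,\dots,V_K)$. An $(n_{\rm s},n_{\rm c},\boldsymbol R)$-code consists of an encoder $f:\mathcal X^{n_{\rm s}}\to\mathcal W^{n_{\rm c}}$, helper encoders $f_k:\mathcal V_k^{n_{\rm s}}\to\{1,\dots,\lfloor 2^{n_{\rm s}R_k}\rfloor\}$ and decoders $g_k:\mathcal U_k^{n_{\rm c}}\times\mathcal Y_k^{n_{\rm s}}\times\{1,\dots,\lfloor 2^{n_{\rm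 s}R_k}\rfloor\}\to\mathcal X^{n_{\rm s}}$, for $1\le k\le K$. The codeword $\mathbf W=f(\mathbf X)$ is sent over $n_{\rm c}$ memoryless uses of $T$ (the outputs depending on the source and side information only through $\mathbf W$), receiver $k$ observes its output sequence $\mathbf U_k$ and forms $\hat{\mathbf X}_k=g_k(\mathbf U_k,\mathbf Y_k,f_k(\mathbf V_k))$. The tuple $(X,Y_1,\dots,Y_K,V_1,\dots,V_K)$ is called $(\kappa,\boldsymbol R)$-achievable if for every $\epsilon>0$, for all sufficiently large $n_{\rm s},n_{\rm c}$ with $n_{\rm c}/n_{\rm s}=\kappa$, there is an $(n_{\rm s},n_{\rm c},\boldsymbol R)$-code with $\Pr[\hat{\mathbf X}_k\ne\mathbf X]\le\epsilon$ for all $k$. **Theorem.** (i) (Achievability.) Suppose that there exist a pmf $P_W$ on $\mathcal W$ and auxiliary random variables $A_1,\dots,A_K$ with finite alphabets, jointly distributed with $(X,Y_1,\dots,Y_K,V_1,\dots,V_K)$, such that for every $k$ the Markov chain $(X,Y_k)\leftrightarrow V_k\leftrightarrow A_k$ holds and $$R_k>I(V_k;A_k\mid Y_k),\qquad H(X\mid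 A_k,Y_k)<\kappa\, I(W;U_k),$$ where $(W,U_1,\dots,U_K)\sim P_W(\cdot)\,T(\cdot\mid\cdot)$. Then the tuple is $(\kappa,\boldsymbol R)$-achievable. (ii) (Converse.) Conversely, if the tuple is $(\kappa,\boldsymbol R)$-achievable, then there exist such $P_W$ and $A_1,\dots,A_K$ with both strict inequalities replaced by the non-strict ones, $R_k\ge I(V_k;A_k\mid Y_k)$ and $H(X\mid A_k,Y_k)\le\kappa\, I(W;U_k)$ for every $k$. The same conclusion holds already if, for every $\epsilon>0$, codes with $n_{\rm c}/n_{\rm s}=\kappa$ and error probabilities at most $\epsilon$ exist for arbitrarily large $n_{\rm s},n_{\rm c}$ (instead of all sufficiently large ones). -/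

import Mathlib

noncomputable section

namespace BSCoop

/-! ### Random variables on a finite probability space

A pmf on a finite set `Ω` is an element `p` of `stdSimplex ℝ Ω`, i.e. a nonnegative function with
sum `1`; a random variable is a function on `Ω`. All logarithms are to base `2`. -/

section Information

variable {Ω α β γ : Type*} [Fintype Ω]

open Classical in
/-- The law (marginal pmf) of the random variable `f` under the pmf `p`. -/
def law (p : Ω → ℝ) (f : Ω → α) (a : α) : ℝ :=
  ∑ ω with f ω = a, p ω

/-- Conditional entropy `H(f | g) = - ∑ p(a,b) log (p(a,b) / p(b))`, in bits. -/
def condEntropy [Fintype α] [Fintype β] (p : Ω → ℝ) (f : Ω → α) (g : Ω → β) : ℝ :=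
  -∑ a, ∑ b, law p (fun ω => (f ω, g ω)) (a, b) *
    Real.logb 2 (law p (fun ω => (f ω, g ω)) (a, b) / law p g b)

/-- Mutual information `I(f ; g) = ∑ p(a,b) log (p(a,b) / (p(a) p(b)))`, in bits. -/
def mutualInfo [Fintype α] [Fintype β] (p : Ω → ℝ) (f : Ω → α) (g : Ω → β) : ℝ :=
  ∑ a, ∑ b, law p (fun ω => (f ω, g ω)) (a, b) *
    Real.logb 2 (law p (fun ω => (f ω, g ω)) (a, b) / (law p f a * law p g b))

/-- Conditional mutual information
`I(f ; g | h) = ∑ p(a,b,c) log (p(a,b,c) p(c) / (p(a,c) p(b,c)))`, in bits. -/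
def condMutualInfo [Fintype α] [Fintype β] [Fintype γ]
    (p : Ω → ℝ) (f : Ω → α) (g : Ω → β) (h : Ω → γ) : ℝ :=
  ∑ a, ∑ b, ∑ c, law p (fun ω => (f ω, g ω, h ω)) (a, b, c) *
    Real.logb 2 (law p (fun ω => (f ω, g ω, h ω)) (a, b, c) * law p h c /
      (law p (fun ω => (f ω, h ω)) (a, c) * law p (fun ω => (g ω, h ω)) (b, c)))

/-- The Markov chain `f ↔ g ↔ h`: `f` and `h` are conditionally independent given `g`, i.e.
`p(a,b,c) p(b) = p(a,b) p(b,c)`. -/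
def IsMarkovChain (p : Ω → ℝ) (f : Ω → α) (g : Ω → β) (h : Ω → γ) : Prop :=
  ∀ a b c, law p (fun ω => (f ω, g ω, h ω)) (a, b, c) * law p g b =
    law p (fun ω => (f ω, g ω)) (a, b) * law p (fun ω => (g ω, h ω)) (b, c)

end Information

/-! ### The communication model -/

section Model

variable {K : ℕ} {X W : Type*} {Y V U : Fin K → Type*}

/-- One letter `(X, Y₁, …, Y_K, V₁, …, V_K)` of the source with side information. -/
abbrev Letter {K : ℕ} (X : Type*) (Y V : Fin K → Type*) :=
  X × (∀ k, Y k) × (∀ k, V k)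

/-- The number `⌊2 ^ (n R)⌋` of helper messages at rate `R` and source blocklength `n`. -/
def numMessages (ns : ℕ) (R : ℝ) : ℕ :=
  ⌊(2 : ℝ) ^ ((ns : ℝ) * R)⌋₊

/-- An `(ns, nc, R₁, …, R_K)`-code: the encoder of the main base station, the encoders of the
helper base stations, and the decoders of the receivers. -/
structure Code {K : ℕ} (X W : Type*) (Y V U : Fin K → Type*) (ns nc : ℕ) (R : Fin K → ℝ) where
  enc : (Fin ns → X) → (Fin nc → W)
  helper : ∀ k, (Fin ns → V k) → Fin (numMessages ns (R k))
  dec : ∀ k, (Fin nc → U k) → (Fin ns → Y k) → Fin (numMessages ns (R k)) → (Fin ns → X)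

open Classical in
/-- The probability that receiver `k` does not recover the source sequence: the source letters
`s 1, …, s ns` are iid with pmf `P`, and the channel outputs `u 1, …, u nc` are drawn from the
codeword through the memoryless channel `T`. -/
def Code.errorProb [Fintype X] [∀ k, Fintype (Y k)] [∀ k, Fintype (V k)] [∀ k, Fintype (U k)]
    {ns nc : ℕ} {R : Fin K → ℝ} (c : Code X W Y V U ns nc R)
    (P : Letter X Y V → ℝ) (T : W → (∀ k, U k) → ℝ) (k : Fin K) : ℝ :=
  ∑ s : Fin ns → Letter X Y V, ∑ u : Fin nc → (∀ k, U k),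
    if c.dec k (fun i => u i k) (fun i => (s i).2.1 k) (c.helper k (fun i => (s i).2.2 k))
        ≠ (fun i => (s i).1)
    then (∏ i, P (s i)) * ∏ i, T (c.enc (fun j => (s j).1) i) (u i)
    else 0

/-- The source with pmf `P` is `(κ, R)`-achievable over the channel `T`: for every `ε > 0`, for all
sufficiently large `ns` and `nc` with `nc / ns = κ` there is an `(ns, nc, R₁, …, R_K)`-code with
error probability at most `ε` at every receiver. -/
def Achievable [Fintype X] [∀ k, Fintype (Y k)] [∀ k, Fintype (V k)] [∀ k, Fintype (U k)]
    (P : Letter X Y V → ℝ) (T : W → (∀ k, U k) → ℝ) (κ : ℚ) (R : Fin K → ℝ) : Prop :=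
  ∀ ε : ℝ, 0 < ε → ∃ N : ℕ, ∀ ns nc : ℕ, N ≤ ns → N ≤ nc → (nc : ℚ) / ns = κ →
    ∃ c : Code X W Y V U ns nc R, ∀ k, c.errorProb P T k ≤ ε

/-- The weaker notion of achievability that asks for such codes only at arbitrarily large
blocklengths, instead of at all sufficiently large ones. -/
def AchievableInfinitelyOften
    [Fintype X] [∀ k, Fintype (Y k)] [∀ k, Fintype (V k)] [∀ k, Fintype (U k)]
    (P : Letter X Y V → ℝ) (T : W → (∀ k, U k) → ℝ) (κ : ℚ) (R : Fin K → ℝ) : Prop :=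
  ∀ ε : ℝ, 0 < ε → ∀ N : ℕ, ∃ ns nc : ℕ, N ≤ ns ∧ N ≤ nc ∧ (nc : ℚ) / ns = κ ∧
    ∃ c : Code X W Y V U ns nc R, ∀ k, c.errorProb P T k ≤ ε

/-- The joint pmf `P_W(w) T(u₁, …, u_K | w)` of `(W, U₁, …, U_K)`. -/
def channelJoint (PW : W → ℝ) (T : W → (∀ k, U k) → ℝ) (z : W × (∀ k, U k)) : ℝ :=
  PW z.1 * T z.1 z.2

/-- The mutual information `I(W ; U_k)` for `(W, U₁, …, U_K) ∼ P_W T`. -/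
def channelInfo [Fintype W] [∀ k, Fintype (U k)]
    (PW : W → ℝ) (T : W → (∀ k, U k) → ℝ) (k : Fin K) : ℝ :=
  mutualInfo (channelJoint PW T) (fun z => z.1) (fun z => z.2 k)

/-- `Q` is a joint pmf of the source letter and auxiliary random variables `A₁, …, A_K` with finite
alphabets of sizes `m 1, …, m K`, such that the source letter has pmf `P` and
`(X, Y_k) ↔ V_k ↔ A_k` is a Markov chain for every `k`. -/
def IsAuxiliary [Fintype X] [∀ k, Fintype (Y k)] [∀ k, Fintype (V k)]
    (P : Letter X Y V → ℝ) (m : Fin K → ℕ) (Q : Letter X Y V × (∀ k, Fin (m k)) → ℝ) : Prop :=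
  Q ∈ stdSimplex ℝ (Letter X Y V × (∀ k, Fin (m k))) ∧
  law Q Prod.fst = P ∧
  ∀ k, IsMarkovChain Q (fun z => (z.1.1, z.1.2.1 k)) (fun z => z.1.2.2 k) (fun z => z.2 k)

/-- The quantity `I(V_k ; A_k | Y_k)`. -/
def helperInfo [Fintype X] [∀ k, Fintype (Y k)] [∀ k, Fintype (V k)]
    (m : Fin K → ℕ) (Q : Letter X Y V × (∀ k, Fin (m k)) → ℝ) (k : Fin K) : ℝ :=
  condMutualInfo Q (fun z => z.1.2.2 k) (fun z => z.2 k) (fun z => z.1.2.1 k)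

/-- The quantity `H(X | A_k, Y_k)`. -/
def equivocation [Fintype X] [∀ k, Fintype (Y k)] [∀ k, Fintype (V k)]
    (m : Fin K → ℕ) (Q : Letter X Y V × (∀ k, Fin (m k)) → ℝ) (k : Fin K) : ℝ :=
  condEntropy Q (fun z => z.1.1) (fun z => (z.2 k, z.1.2.1 k))

end Model

end BSCoop

end

noncomputable section

namespace BSCoop

/-!
Achievability is a one-shot bound followed by the law of large numbers. The main encoder maps each
source value to an independent random codeword. Helper `k` quantizes its observation to a word of a
random codebook drawn from the law of `A_k`, which succeeds when the codebook has more than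
`2 ^ I(V_k; A_k)` words, and announces only the bin of that word; receiver `k` looks for the source
value that is typical with the channel output, its side information and some word of the announced
bin. For iid sequences the information densities concentrate at the mutual informations, so the
bound tends to zero under the strict inequalities; since only the main encoder is shared, the
receivers' error probabilities are summed before it is derandomized.

For the converse, let `A_i` consist of the message of helper `k`, the source letters before time `i`
and the side information of receiver `k` after time `i`. This turns `H(Xⁿ | message, Yⁿ)` and the
rate of the helper into sums of single-letter conditional entropies, and Fano's inequality with the
channel coding converse bounds the former by `ε n + n_c I(W; U_k)`. The pairs
`(H(X | A, Y), H(S | A, Y))`, with `S` the whole source letter and `A` obtained from `V_k` through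
a finite-alphabet channel, form a convex set, which absorbs the average over `i`; by Carathéodory's
theorem it is compact, so that an exact solution survives the limit `ε → 0`.
-/

open Finset Real Filter

section Expectation

variable {Ω Ω' : Type*} [Fintype Ω] [Fintype Ω']

open Classical in
/-- The indicator of a proposition, as a real number. -/
def ind (E : Prop) : ℝ := if E then 1 else 0

/-- The expectation of the random variable `F` under the pmf `p`; it is also used for nonnegative
`p` of arbitrary total mass. -/
def expect (p F : Ω → ℝ) : ℝ := ∑ ω, p ω * F ω

/-- The probability of the event `E` under the pmf `p`. -/
def prob (p : Ω → ℝ) (E : Ω → Prop) : ℝ := expect p fun ω => ind (E ω)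

lemma ind_of {E : Prop} (h : E) : ind E = 1 := if_pos h

lemma ind_of_not {E : Prop} (h : ¬E) : ind E = 0 := if_neg h

lemma ind_nonneg (E : Prop) : 0 ≤ ind E := by
  unfold ind; split_ifs <;> norm_num

lemma ind_le_one (E : Prop) : ind E ≤ 1 := by
  unfold ind; split_ifs <;> norm_num

lemma ind_le {E : Prop} {a : ℝ} (ha : 0 ≤ a) (h : E → 1 ≤ a) : ind E ≤ a := by
  unfold ind; split_ifs with hE
  exacts [h hE, ha]

lemma ind_mono {E E' : Prop} (h : E → E') : ind E ≤ ind E' :=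
  ind_le (ind_nonneg _) fun hE => (ind_of (h hE)).ge

lemma ind_and (E E' : Prop) : ind (E ∧ E') = ind E * ind E' := by
  by_cases h : E <;> by_cases h' : E' <;> simp [ind, h, h']

lemma ind_or_le (E E' : Prop) : ind (E ∨ E') ≤ ind E + ind E' := by
  have := ind_nonneg E
  have := ind_nonneg E'
  refine ind_le (by linarith) fun h => ?_
  rcases h with h | h <;> rw [ind_of h] <;> linarith

lemma ind_exists_le {ι : Type*} [Fintype ι] (E : ι → Prop) : ind (∃ i, E i) ≤ ∑ i, ind (E i) := by
  refine ind_le (sum_nonneg fun i _ => ind_nonneg _) fun ⟨i, hi⟩ => ?_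
  rw [← ind_of hi]
  exact single_le_sum (f := fun i => ind (E i)) (fun j _ => ind_nonneg _) (mem_univ i)

lemma nonempty_of_mem_stdSimplex {p : Ω → ℝ} (hp : p ∈ stdSimplex ℝ Ω) : Nonempty Ω := by
  by_contra h
  have := not_nonempty_iff.1 h
  rwa [stdSimplex_of_isEmpty_index] at hp

lemma expect_congr {p F G : Ω → ℝ} (h : ∀ ω, p ω ≠ 0 → F ω = G ω) : expect p F = expect p G := by
  refine sum_congr rfl fun ω _ => ?_
  by_cases hω : p ω = 0
  · simp [hω]
  · rw [h ω hω]

lemma expect_mono {p F G : Ω → ℝ} (hp : ∀ ω, 0 ≤ p ω) (h : ∀ ω, p ω ≠ 0 → F ω ≤ G ω) :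
    expect p F ≤ expect p G := by
  refine sum_le_sum fun ω _ => ?_
  by_cases hω : p ω = 0
  · simp [hω]
  · exact mul_le_mul_of_nonneg_left (h ω hω) (hp ω)

lemma expect_nonneg {p F : Ω → ℝ} (hp : ∀ ω, 0 ≤ p ω) (hF : ∀ ω, 0 ≤ F ω) : 0 ≤ expect p F :=
  sum_nonneg fun ω _ => mul_nonneg (hp ω) (hF ω)

lemma expect_add (p F G : Ω → ℝ) :
    expect p (fun ω => F ω + G ω) = expect p F + expect p G := by
  simp only [expect, mul_add, sum_add_distrib]

lemma expect_sub (p F G : Ω → ℝ) :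
    expect p (fun ω => F ω - G ω) = expect p F - expect p G := by
  simp only [expect, mul_sub, sum_sub_distrib]

lemma expect_neg (p F : Ω → ℝ) : expect p (fun ω => -F ω) = -expect p F := by
  simp only [expect, mul_neg, sum_neg_distrib]

lemma expect_const_mul (p : Ω → ℝ) (c : ℝ) (F : Ω → ℝ) :
    expect p (fun ω => c * F ω) = c * expect p F := by
  simp only [expect, mul_sum, mul_left_comm]

lemma expect_mul_const (p F : Ω → ℝ) (c : ℝ) :
    expect p (fun ω => F ω * c) = expect p F * c := by
  simp only [expect, sum_mul, mul_assoc]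

lemma expect_const {p : Ω → ℝ} (hp : p ∈ stdSimplex ℝ Ω) (c : ℝ) :
    expect p (fun _ => c) = c := by
  simp only [expect, ← sum_mul, hp.2, one_mul]

lemma expect_sum {ι : Type*} (s : Finset ι) (p : Ω → ℝ) (F : ι → Ω → ℝ) :
    expect p (fun ω => ∑ i ∈ s, F i ω) = ∑ i ∈ s, expect p (F i) := by
  simp only [expect, mul_sum]
  exact sum_comm

lemma expect_comm (p : Ω → ℝ) (q : Ω' → ℝ) (F : Ω → Ω' → ℝ) :
    expect p (fun ω => expect q (F ω)) = expect q fun ω' => expect p fun ω => F ω ω' := by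
  simp only [expect, mul_sum]
  rw [sum_comm]
  simp only [mul_left_comm]

lemma prob_nonneg {p : Ω → ℝ} (hp : ∀ ω, 0 ≤ p ω) (E : Ω → Prop) : 0 ≤ prob p E :=
  expect_nonneg hp fun _ => ind_nonneg _

lemma prob_mono {p : Ω → ℝ} (hp : ∀ ω, 0 ≤ p ω) {E E' : Ω → Prop}
    (h : ∀ ω, p ω ≠ 0 → E ω → E' ω) : prob p E ≤ prob p E' :=
  expect_mono hp fun ω hω => ind_mono (h ω hω)

lemma exists_le_of_expect_le {p F : Ω → ℝ} (hp : p ∈ stdSimplex ℝ Ω) {τ : ℝ}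
    (h : expect p F ≤ τ) : ∃ ω, F ω ≤ τ := by
  by_contra! hc
  have hle : ∑ ω, p ω * τ ≤ ∑ ω, p ω * F ω :=
    sum_le_sum fun ω _ => mul_le_mul_of_nonneg_left (hc ω).le (hp.1 ω)
  have hzero : ∀ ω ∈ univ, p ω * τ = p ω * F ω :=
    (sum_eq_sum_iff_of_le fun ω _ => mul_le_mul_of_nonneg_left (hc ω).le (hp.1 ω)).1
      (le_antisymm hle (by rwa [← sum_mul, hp.2, one_mul]))
  have : ∑ ω, p ω = 0 := sum_eq_zero fun ω hω =>
    (mul_eq_mul_left_iff.1 (hzero ω hω)).resolve_left (hc ω).ne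
  rw [hp.2] at this
  exact one_ne_zero this

end Expectation

section Law

variable {Ω α β : Type*} [Fintype Ω]

lemma law_eq_prob (p : Ω → ℝ) (f : Ω → α) (a : α) : law p f a = prob p fun ω => f ω = a := by
  simp [law, prob, expect, ind, sum_filter]

lemma law_nonneg {p : Ω → ℝ} (hp : ∀ ω, 0 ≤ p ω) (f : Ω → α) (a : α) : 0 ≤ law p f a :=
  sum_nonneg fun ω _ => hp ω

lemma law_pos {p : Ω → ℝ} (hp : ∀ ω, 0 ≤ p ω) (f : Ω → α) {ω : Ω} (hω : p ω ≠ 0) :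
    0 < law p f (f ω) :=
  sum_pos' (fun ω _ => hp ω) ⟨ω, by simp, (hp ω).lt_of_ne' hω⟩

lemma law_congr (p : Ω → ℝ) {f : Ω → α} {g : Ω → β} {a : α} {b : β}
    (h : ∀ ω, f ω = a ↔ g ω = b) : law p f a = law p g b := by
  simp only [law_eq_prob, h]

lemma law_id (p : Ω → ℝ) : law p id = p := by
  classical
  funext ω
  simp [law, sum_filter]

lemma law_prodMk_swap (p : Ω → ℝ) (f : Ω → α) (g : Ω → β) (a : α) (b : β) :
    law p (fun ω => (f ω, g ω)) (a, b) = law p (fun ω => (g ω, f ω)) (b, a) :=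
  law_congr p fun ω => by simp only [Prod.mk.injEq, and_comm]

lemma expect_law [Fintype α] (p : Ω → ℝ) (f : Ω → α) (F : α → ℝ) :
    expect (law p f) F = expect p fun ω => F (f ω) := by
  classical
  simp only [expect, law, sum_mul]
  rw [← sum_fiberwise univ f]
  exact sum_congr rfl fun a _ => sum_congr (by ext; simp) fun ω hω => by
    rw [(mem_filter.1 hω).2]

lemma law_law [Fintype α] (p : Ω → ℝ) (f : Ω → α) (g : α → β) :
    law (law p f) g = law p fun ω => g (f ω) := by
  funext b
  rw [law_eq_prob, law_eq_prob]
  exact expect_law p f fun a => ind (g a = b)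

lemma law_mem_stdSimplex [Fintype α] {p : Ω → ℝ} (hp : p ∈ stdSimplex ℝ Ω) (f : Ω → α) :
    law p f ∈ stdSimplex ℝ α := by
  refine ⟨law_nonneg hp.1 f, ?_⟩
  simpa [expect, hp.2] using expect_law p f fun _ => 1

lemma law_snd_eq_sum [Fintype α] (p : Ω → ℝ) (f : Ω → α) (g : Ω → β) (b : β) :
    ∑ a, law p (fun ω => (f ω, g ω)) (a, b) = law p g b := by
  classical
  simp only [law, sum_filter, Prod.mk.injEq]
  rw [sum_comm]
  simp [ite_and]

end Law

section Joint

variable {Ω U α β : Type*} [Fintype Ω] [Fintype U]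

/-- The joint pmf of the input and the output of the channel `t` when the input has pmf `p`. -/
def jointPmf (p : Ω → ℝ) (t : Ω → U → ℝ) (z : Ω × U) : ℝ := p z.1 * t z.1 z.2

lemma expect_jointPmf (p : Ω → ℝ) (t : Ω → U → ℝ) (F : Ω × U → ℝ) :
    expect (jointPmf p t) F = expect p fun ω => expect (t ω) fun u => F (ω, u) := by
  simp only [expect, jointPmf, Fintype.sum_prod_type, mul_sum, mul_assoc]

lemma jointPmf_mem_stdSimplex {p : Ω → ℝ} (hp : p ∈ stdSimplex ℝ Ω) {t : Ω → U → ℝ}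
    (ht : ∀ ω, t ω ∈ stdSimplex ℝ U) : jointPmf p t ∈ stdSimplex ℝ (Ω × U) := by
  refine ⟨fun z => mul_nonneg (hp.1 _) ((ht _).1 _), ?_⟩
  simpa [expect, (ht _).2, hp.2] using expect_jointPmf p t fun _ => 1

lemma law_jointPmf_fst (p : Ω → ℝ) {t : Ω → U → ℝ} (ht : ∀ ω, t ω ∈ stdSimplex ℝ U) :
    law (jointPmf p t) Prod.fst = p := by
  classical
  funext ω
  rw [law_eq_prob, prob, expect_jointPmf]
  simp only [expect_const (ht _)]
  simp [expect, ind]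

lemma law_jointPmf_comp_fst (p : Ω → ℝ) {t : Ω → U → ℝ}
    (ht : ∀ ω, t ω ∈ stdSimplex ℝ U) (g : Ω → α) :
    law (jointPmf p t) (fun z => g z.1) = law p g := by
  rw [← law_law (jointPmf p t) Prod.fst g, law_jointPmf_fst p ht]

lemma law_jointPmf_snd (p : Ω → ℝ) (t : Ω → U → ℝ) (u : U) :
    law (jointPmf p t) Prod.snd u = expect p fun ω => t ω u := by
  classical
  rw [law_eq_prob, prob, expect_jointPmf]
  simp [expect, ind]

lemma law_jointPmf_map_fst (p : Ω → ℝ) (f : Ω → α) (t : α → U → ℝ) :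
    law (jointPmf p fun ω => t (f ω)) (fun z => (f z.1, z.2)) = jointPmf (law p f) t := by
  classical
  funext ⟨a, u⟩
  have : ∀ ω, expect (t (f ω)) (fun u' => ind ((f ω, u') = (a, u))) = ind (f ω = a) * t a u := by
    intro ω
    by_cases h : f ω = a <;> simp [expect, ind, h]
  simp only [law_eq_prob, prob, expect_jointPmf, this, expect_mul_const, jointPmf]

lemma law_jointPmf_map_snd (p : Ω → ℝ) (t : Ω → U → ℝ) (g : U → β) :
    law (jointPmf p t) (fun z => (z.1, g z.2)) = jointPmf p fun ω => law (t ω) g := by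
  classical
  funext ⟨ω, b⟩
  have : ∀ ω', expect (t ω') (fun u => ind ((ω', g u) = (ω, b)))
      = ind (ω' = ω) * law (t ω') g b := by
    intro ω'
    by_cases h : ω' = ω <;> simp [expect, ind, law, sum_filter, h]
  rw [law_eq_prob, prob, expect_jointPmf]
  simp only [this]
  simp [expect, ind, jointPmf]

lemma isMarkovChain_jointPmf [Finite β] (p : Ω → ℝ) (f : Ω → α) (v : Ω → β)
    {q : β → U → ℝ} (hq : ∀ b, q b ∈ stdSimplex ℝ U) :
    IsMarkovChain (jointPmf p fun ω => q (v ω)) (fun z => f z.1) (fun z => v z.1) Prod.snd := by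
  have := Fintype.ofFinite β
  intro a b u
  set J := jointPmf p fun ω => q (v ω)
  have hv : law J (fun z => (v z.1, z.2)) (b, u) = law p v b * q b u :=
    congrFun (law_jointPmf_map_fst p v q) (b, u)
  have hfv : law J (fun z => (f z.1, v z.1, z.2)) (a, b, u)
      = law p (fun ω => (f ω, v ω)) (a, b) * q b u :=
    (law_congr J fun z => by simp only [Prod.mk.injEq, and_assoc]).trans
      (congrFun (law_jointPmf_map_fst p (fun ω => (f ω, v ω)) fun c => q c.2) ((a, b), u))
  rw [hv, hfv, law_jointPmf_comp_fst p (fun ω => hq (v ω)) v,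
    law_jointPmf_comp_fst p (fun ω => hq (v ω)) fun ω => (f ω, v ω)]
  ring

end Joint

section Product

section Dependent

variable {ι : Type*} {α : ι → Type*} [Fintype ι]

/-- The pmf of a family of independent letters, the `i`-th of which has pmf `p i`. -/
def piPmf (p : ∀ i, α i → ℝ) (s : ∀ i, α i) : ℝ := ∏ i, p i (s i)

lemma ne_zero_of_piPmf_ne_zero {p : ∀ i, α i → ℝ} {s : ∀ i, α i} (hs : piPmf p s ≠ 0) (i : ι) :
    p i (s i) ≠ 0 :=
  prod_ne_zero_iff.1 hs i (mem_univ i)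

variable [DecidableEq ι] [∀ i, Fintype (α i)]

lemma expect_piPmf_prod (p F : ∀ i, α i → ℝ) :
    expect (piPmf p) (fun s => ∏ i, F i (s i)) = ∏ i, expect (p i) (F i) := by
  simp only [expect, piPmf, ← prod_mul_distrib, prod_univ_sum, Fintype.piFinset_univ]

lemma piPmf_mem_stdSimplex {p : ∀ i, α i → ℝ} (hp : ∀ i, p i ∈ stdSimplex ℝ (α i)) :
    piPmf p ∈ stdSimplex ℝ (∀ i, α i) := by
  refine ⟨fun s => prod_nonneg fun i _ => (hp i).1 _, ?_⟩
  simpa [expect, (hp _).2] using expect_piPmf_prod p fun _ _ => 1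

lemma law_piPmf_apply {p : ∀ i, α i → ℝ} (hp : ∀ i, p i ∈ stdSimplex ℝ (α i)) (i : ι) :
    law (piPmf p) (fun s => s i) = p i := by
  classical
  funext a
  have h : ∀ s : ∀ i, α i, ind (s i = a)
      = ∏ j, if hj : j = i then ind (s j = hj ▸ a) else 1 := by
    intro s
    rw [Finset.prod_eq_single i (fun j _ hj => dif_neg hj) (by simp), dif_pos rfl]
  simp only [law_eq_prob, prob, h]
  rw [expect_piPmf_prod p fun j b => if hj : j = i then ind (b = hj ▸ a) else 1,
    Finset.prod_eq_single i (fun j _ hj => by simp [hj, expect_const (hp j)]) (by simp)]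
  simp [expect, ind]

end Dependent

variable {ι α β γ δ : Type*} [Fintype ι]

/-- The pmf of an iid sequence of `n` letters. -/
abbrev iid (n : ℕ) (p : α → ℝ) : (Fin n → α) → ℝ := piPmf fun _ => p

variable [DecidableEq ι] [Fintype α]

lemma law_piPmf_map (p : ι → α → ℝ) (f : ι → α → β) :
    law (piPmf p) (fun s i => f i (s i)) = piPmf fun i => law (p i) (f i) := by
  funext t
  have h : ∀ s : ι → α, ind ((fun i => f i (s i)) = t) = ∏ i, ind (f i (s i) = t i) := by
    classical
    intro s
    simp [ind, funext_iff, Finset.prod_ite_zero]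
  simp only [law_eq_prob, prob, h, piPmf]
  exact expect_piPmf_prod p fun i a => ind (f i a = t i)

lemma expect_piPmf_apply {p : ι → α → ℝ} (hp : ∀ i, p i ∈ stdSimplex ℝ α) (i : ι) (F : α → ℝ) :
    expect (piPmf p) (fun s => F (s i)) = expect (p i) F := by
  rw [← expect_law (piPmf p) (fun s => s i), law_piPmf_apply hp]

lemma expect_piPmf_apply_mul_apply {p : ι → α → ℝ} (hp : ∀ i, p i ∈ stdSimplex ℝ α) {i j : ι}
    (hij : i ≠ j) (F G : α → ℝ) :
    expect (piPmf p) (fun s => F (s i) * G (s j)) = expect (p i) F * expect (p j) G := by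
  have h : ∀ s : ι → α, F (s i) * G (s j)
      = ∏ l, (if l = i then F (s l) else 1) * if l = j then G (s l) else 1 := by
    intro s
    rw [prod_mul_distrib, prod_ite_eq' univ i, prod_ite_eq' univ j]
    simp
  simp only [h]
  rw [expect_piPmf_prod p fun l a => (if l = i then F a else 1) * if l = j then G a else 1,
    Finset.prod_eq_mul i j hij (fun l _ hl => by simp [hl.1, hl.2, expect_const (hp l)])
      (by simp) (by simp)]
  simp [hij, hij.symm]

lemma law_piPmf_prodMk (p : ι → α → ℝ) (f : α → β) (g : α → γ) (b : ι → β) (c : ι → γ) :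
    law (piPmf p) (fun s => ((fun i => f (s i)), fun i => g (s i))) (b, c)
      = ∏ i, law (p i) (fun a => (f a, g a)) (b i, c i) := by
  refine Eq.trans (law_congr _ fun s => ?_)
    (congrFun (law_piPmf_map p fun _ a => (f a, g a)) fun i => (b i, c i))
  simp only [Prod.mk.injEq, funext_iff, forall_and]

lemma law_piPmf_prodMk₃ (p : ι → α → ℝ) (f : α → β) (g : α → γ) (h : α → δ)
    (b : ι → β) (c : ι → γ) (d : ι → δ) :
    law (piPmf p) (fun s => ((fun i => f (s i)), (fun i => g (s i)), fun i => h (s i))) (b, c, d)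
      = ∏ i, law (p i) (fun a => (f a, g a, h a)) (b i, c i, d i) := by
  refine Eq.trans (law_congr _ fun s => ?_)
    (congrFun (law_piPmf_map p fun _ a => (f a, g a, h a)) fun i => (b i, c i, d i))
  simp only [Prod.mk.injEq, funext_iff, forall_and]

lemma expect_piPmf_update {p : ι → α → ℝ} (hp : ∀ i, p i ∈ stdSimplex ℝ α) (i : ι)
    (F : (ι → α) → ℝ) :
    expect (p i) (fun a => expect (piPmf p) fun s => F (Function.update s i a))
      = expect (piPmf p) F := by
  have hswap : ∀ (s : ι → α) (a : α),
      p i a * piPmf p s = p i (s i) * piPmf p (Function.update s i a) := by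
    intro s a
    have h : ∏ j ∈ univ.erase i, p j (Function.update s i a j) = ∏ j ∈ univ.erase i, p j (s j) :=
      prod_congr rfl fun j hj => by rw [Function.update_of_ne (ne_of_mem_erase hj)]
    unfold piPmf
    rw [← mul_prod_erase univ _ (mem_univ i), ← mul_prod_erase univ _ (mem_univ i), h,
      Function.update_self]
    ring
  let σ : α × (ι → α) ≃ α × (ι → α) := Function.Involutive.toPerm
    (fun z => (z.2 i, Function.update z.2 i z.1)) fun z => by simp
  calc expect (p i) (fun a => expect (piPmf p) fun s => F (Function.update s i a))
      = ∑ z : α × (ι → α), p i (σ z).1 * piPmf p (σ z).2 * F (σ z).2 := by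
        simp only [expect, mul_sum, Fintype.sum_prod_type]
        exact sum_congr rfl fun a _ => sum_congr rfl fun s _ => by
          rw [← mul_assoc, hswap]; rfl
    _ = ∑ z : α × (ι → α), p i z.1 * piPmf p z.2 * F z.2 :=
        σ.sum_comp fun z => p i z.1 * piPmf p z.2 * F z.2
    _ = expect (piPmf p) F := by
        simp only [Fintype.sum_prod_type, mul_assoc, ← mul_sum, ← sum_mul, (hp i).2, one_mul,
          expect]

lemma law_piPmf_apply_prodMk {p : ι → α → ℝ}
    (hp : ∀ i, p i ∈ stdSimplex ℝ α) (i : ι) {F : (ι → α) → β} {G : α → (ι → α) → β}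
    (hFG : ∀ s a, F (Function.update s i a) = G a s) :
    law (piPmf p) (fun s => (s i, F s)) = jointPmf (p i) fun a => law (piPmf p) (G a) := by
  classical
  funext ⟨a, b⟩
  rw [law_eq_prob, prob, ← expect_piPmf_update hp i]
  have : ∀ a', expect (piPmf p) (fun s => ind ((a', G a' s) = (a, b)))
      = ind (a' = a) * law (piPmf p) (G a') b := by
    intro a'
    by_cases h : a' = a <;> simp [expect, ind, law, sum_filter, h]
  simp only [Function.update_self, hFG, this]
  simp [expect, ind, jointPmf]

end Product

section Information

variable {Ω Ω' α β γ δ : Type*} [Fintype Ω] [Fintype Ω'] [Fintype α] [Fintype β] [Fintype γ]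
  [Fintype δ]

lemma condEntropy_eq_expect (p : Ω → ℝ) (f : Ω → α) (g : Ω → β) :
    condEntropy p f g = expect p fun ω =>
      -logb 2 (law p (fun ω => (f ω, g ω)) (f ω, g ω) / law p g (g ω)) := by
  rw [expect_neg, ← expect_law p (fun ω => (f ω, g ω)) fun z =>
    logb 2 (law p (fun ω => (f ω, g ω)) z / law p g z.2), expect, Fintype.sum_prod_type]
  rfl

lemma mutualInfo_eq_expect (p : Ω → ℝ) (f : Ω → α) (g : Ω → β) :
    mutualInfo p f g = expect p fun ω =>
      logb 2 (law p (fun ω => (f ω, g ω)) (f ω, g ω) / (law p f (f ω) * law p g (g ω))) := by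
  rw [← expect_law p (fun ω => (f ω, g ω)) fun z =>
    logb 2 (law p (fun ω => (f ω, g ω)) z / (law p f z.1 * law p g z.2)), expect,
    Fintype.sum_prod_type]
  rfl

lemma condMutualInfo_eq_expect (p : Ω → ℝ) (f : Ω → α) (g : Ω → β) (h : Ω → γ) :
    condMutualInfo p f g h = expect p fun ω =>
      logb 2 (law p (fun ω => (f ω, g ω, h ω)) (f ω, g ω, h ω) * law p h (h ω) /
        (law p (fun ω => (f ω, h ω)) (f ω, h ω) * law p (fun ω => (g ω, h ω)) (g ω, h ω))) := by
  rw [← expect_law p (fun ω => (f ω, g ω, h ω)) fun z =>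
    logb 2 (law p (fun ω => (f ω, g ω, h ω)) z * law p h z.2.2 /
      (law p (fun ω => (f ω, h ω)) (z.1, z.2.2) * law p (fun ω => (g ω, h ω)) z.2)), expect]
  simp only [Fintype.sum_prod_type]
  rfl

lemma condEntropy_comp (p : Ω → ℝ) (h : Ω → Ω') (f : Ω' → α) (g : Ω' → β) :
    condEntropy p (fun ω => f (h ω)) (fun ω => g (h ω)) = condEntropy (law p h) f g := by
  simp only [condEntropy, law_law]

lemma mutualInfo_comp (p : Ω → ℝ) (h : Ω → Ω') (f : Ω' → α) (g : Ω' → β) :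
    mutualInfo p (fun ω => f (h ω)) (fun ω => g (h ω)) = mutualInfo (law p h) f g := by
  simp only [mutualInfo, law_law]

lemma condMutualInfo_comp (p : Ω → ℝ) (k : Ω → Ω') (f : Ω' → α) (g : Ω' → β) (h : Ω' → γ) :
    condMutualInfo p (fun ω => f (k ω)) (fun ω => g (k ω)) (fun ω => h (k ω))
      = condMutualInfo (law p k) f g h := by
  simp only [condMutualInfo, law_law]

lemma condEntropy_congr (p : Ω → ℝ) {f : Ω → α} {g : Ω → β} {f' : Ω → γ} {g' : Ω → δ}
    (hg : ∀ ω ω', g ω = g ω' ↔ g' ω = g' ω')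
    (hf : ∀ ω ω', g ω = g ω' → (f ω = f ω' ↔ f' ω = f' ω')) :
    condEntropy p f g = condEntropy p f' g' := by
  simp only [condEntropy_eq_expect]
  refine expect_congr fun ω _ => ?_
  rw [law_congr p fun ω' => hg ω' ω, law_congr p (f := fun ω => (f ω, g ω))
    (g := fun ω => (f' ω, g' ω)) (b := (f' ω, g' ω)) fun ω' => ?_]
  simp only [Prod.mk.injEq, ← hg]
  exact and_congr_left (hf ω' ω)

lemma condEntropy_prodMk {p : Ω → ℝ} (hp : ∀ ω, 0 ≤ p ω) (f : Ω → α) (g : Ω → β) (h : Ω → γ) :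
    condEntropy p (fun ω => (f ω, g ω)) h
      = condEntropy p g h + condEntropy p f (fun ω => (g ω, h ω)) := by
  simp only [condEntropy_eq_expect, ← expect_add]
  refine expect_congr fun ω hω => ?_
  have h₁ := law_pos hp h hω
  have h₂ := law_pos hp (fun ω => (g ω, h ω)) hω
  have h₃ := law_pos hp (fun ω => (f ω, g ω, h ω)) hω
  rw [law_congr p (f := fun ω => ((f ω, g ω), h ω)) (g := fun ω => (f ω, g ω, h ω))
    (b := (f ω, g ω, h ω)) fun ω' => by simp only [Prod.mk.injEq, and_assoc],
    ← neg_add, ← logb_mul (by positivity) (by positivity)]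
  field_simp

lemma expect_logb_law_div_nonneg {p : Ω → ℝ} (hp : ∀ ω, 0 ≤ p ω) (f : Ω → α) {q : α → ℝ}
    (hq : ∀ a, 0 ≤ q a) (hpos : ∀ ω, p ω ≠ 0 → 0 < q (f ω)) (hsum : ∑ a, q a ≤ ∑ ω, p ω) :
    0 ≤ expect p fun ω => logb 2 (law p f (f ω) / q (f ω)) := by
  have hratio : expect p (fun ω => q (f ω) / law p f (f ω)) ≤ ∑ a, q a := by
    rw [← expect_law p f fun a => q a / law p f a]
    refine sum_le_sum fun a _ => ?_
    rcases eq_or_ne (law p f a) 0 with h | h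
    · simpa [h] using hq a
    · rw [mul_div_cancel₀ _ h]
  have hlog : expect p (fun ω => (1 - q (f ω) / law p f (f ω)) * (log 2)⁻¹)
      ≤ expect p fun ω => logb 2 (law p f (f ω) / q (f ω)) := by
    refine expect_mono hp fun ω hω => ?_
    have h₁ := law_pos hp f hω
    have h₂ := hpos ω hω
    have := one_sub_inv_le_log_of_pos (div_pos h₁ h₂)
    rw [inv_div] at this
    rw [logb, div_eq_mul_inv (log _)]
    exact mul_le_mul_of_nonneg_right this (inv_nonneg.2 (log_nonneg one_le_two))
  refine le_trans ?_ hlog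
  rw [expect_mul_const, expect_sub]
  refine mul_nonneg (sub_nonneg.2 (hratio.trans (hsum.trans_eq ?_)))
    (inv_nonneg.2 (log_nonneg one_le_two))
  simp [expect]

lemma condEntropy_le_expect {p : Ω → ℝ} (hp : ∀ ω, 0 ≤ p ω) (f : Ω → α) (g : Ω → β)
    {r : β → α → ℝ} (hr : ∀ b a, 0 ≤ r b a) (hr1 : ∀ b, ∑ a, r b a ≤ 1)
    (hpos : ∀ ω, p ω ≠ 0 → 0 < r (g ω) (f ω)) :
    condEntropy p f g ≤ expect p fun ω => -logb 2 (r (g ω) (f ω)) := by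
  have hgibbs := expect_logb_law_div_nonneg hp (fun ω => (f ω, g ω))
    (q := fun z => law p g z.2 * r z.2 z.1) (fun z => mul_nonneg (law_nonneg hp g _) (hr _ _))
    (fun ω hω => mul_pos (law_pos hp g hω) (hpos ω hω)) ?_
  · rw [condEntropy_eq_expect, ← sub_nonneg, ← expect_sub]
    refine hgibbs.trans_eq (expect_congr fun ω hω => ?_)
    have h₁ := law_pos hp (fun ω => (f ω, g ω)) hω
    have h₂ := law_pos hp g hω
    rw [← div_div, logb_div (by positivity) (hpos ω hω).ne']
    ring
  · have hlaw : ∑ b, law p g b = ∑ ω, p ω := by simpa [expect] using expect_law p g fun _ => 1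
    rw [Fintype.sum_prod_type_right, ← hlaw]
    refine sum_le_sum fun b _ => ?_
    simp only [← mul_sum]
    exact mul_le_of_le_one_right (law_nonneg hp g b) (hr1 b)

lemma condEntropy_nonneg {p : Ω → ℝ} (hp : ∀ ω, 0 ≤ p ω) (f : Ω → α) (g : Ω → β) :
    0 ≤ condEntropy p f g := by
  rw [condEntropy_eq_expect]
  refine sum_nonneg fun ω _ => ?_
  by_cases hω : p ω = 0
  · simp [hω]
  refine mul_nonneg (hp ω) (neg_nonneg.2 (logb_nonpos one_lt_two
    (div_nonneg (law_nonneg hp _ _) (law_nonneg hp _ _))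
    (div_le_one_of_le₀ ?_ (law_nonneg hp _ _))))
  rw [← law_snd_eq_sum p f g]
  exact single_le_sum (fun a _ => law_nonneg hp (fun ω => (f ω, g ω)) (a, g ω)) (mem_univ (f ω))

lemma condEntropy_le_of_factorsThrough {p : Ω → ℝ} (hp : ∀ ω, 0 ≤ p ω) (f : Ω → α) {g : Ω → β}
    {h : Ω → γ} (hgh : h.FactorsThrough g) : condEntropy p f g ≤ condEntropy p f h := by
  rcases isEmpty_or_nonempty Ω with _ | ⟨⟨ω₀⟩⟩
  · simp [condEntropy_eq_expect, expect]
  set φ : β → γ := Function.extend g h fun _ => h ω₀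
  have hφ : ∀ ω, φ (g ω) = h ω := hgh.extend_apply _
  have hbound := condEntropy_le_expect hp f g
    (r := fun b a => law p (fun ω => (f ω, h ω)) (a, φ b) / law p h (φ b))
    (fun b a => div_nonneg (law_nonneg hp _ _) (law_nonneg hp _ _))
    (fun b => by rw [← sum_div, law_snd_eq_sum]; exact div_self_le_one _)
    (fun ω hω => by
      rw [hφ]; exact div_pos (law_pos hp (fun ω => (f ω, h ω)) hω) (law_pos hp h hω))
  simpa only [hφ, ← condEntropy_eq_expect] using hbound

lemma condEntropy_le_logb_card {p : Ω → ℝ} (hp : p ∈ stdSimplex ℝ Ω) (f : Ω → α) (g : Ω → β) :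
    condEntropy p f g ≤ logb 2 (Fintype.card α) := by
  have hcard : ∀ ω, p ω ≠ 0 → (0 : ℝ) < (Fintype.card α : ℝ)⁻¹ := fun ω _ => by
    have : Nonempty α := ⟨f ω⟩
    positivity
  have h := condEntropy_le_expect hp.1 f g (r := fun _ _ => (Fintype.card α : ℝ)⁻¹)
    (fun _ _ => by positivity) (fun _ => by simp [mul_inv_le_one]) hcard
  rwa [expect_const hp, logb_inv, neg_neg] at h

lemma condEntropy_le_of_decoder {p : Ω → ℝ} (hp : p ∈ stdSimplex ℝ Ω) (f : Ω → α) (g : Ω → β)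
    (dec : β → α) :
    condEntropy p f g ≤ 1 + prob p (fun ω => dec (g ω) ≠ f ω) * logb 2 (Fintype.card α) := by
  classical
  -- Half of the mass of the guess sits on the decoded value, the other half is uniform.
  set N : ℝ := (Fintype.card α : ℝ)
  have hN : α → 1 ≤ N := fun a => by
    have : Nonempty α := ⟨a⟩
    exact Nat.one_le_cast.2 Fintype.card_pos
  set r : β → α → ℝ := fun b a => 2⁻¹ * (if dec b = a then 1 else 0) + 2⁻¹ * N⁻¹
  have hr : ∀ b a, 0 < r b a := fun _ a => by
    have := hN a
    positivity
  refine (condEntropy_le_expect hp.1 f g (r := r) (fun b a => (hr b a).le) (fun b => ?_)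
    fun ω _ => hr _ _).trans ?_
  · have := hN (dec b)
    simp only [r, sum_add_distrib, ← mul_sum, sum_ite_eq, mem_univ, if_true, sum_const, card_univ,
      nsmul_eq_mul]
    change 2⁻¹ * 1 + 2⁻¹ * (N * N⁻¹) ≤ 1
    rw [mul_inv_cancel₀ (by positivity)]
    norm_num
  rw [← expect_const hp 1, prob, ← expect_mul_const, ← expect_add]
  refine expect_mono hp.1 fun ω _ => ?_
  have hN1 := hN (f ω)
  have : 0 < N := by positivity
  by_cases hdec : dec (g ω) = f ω
  · rw [ind_of_not (not_not.2 hdec), zero_mul, add_zero, neg_le, le_logb_iff_rpow_le one_lt_two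
      (hr _ _)]
    simp only [r, if_pos hdec, rpow_neg_one]
    have : 0 ≤ 2⁻¹ * N⁻¹ := by positivity
    linarith
  · simp only [r, if_neg hdec, mul_zero, zero_add, ind_of hdec, one_mul]
    rw [logb_mul (by norm_num) (by positivity), logb_inv, logb_inv, logb_self_eq_one one_lt_two]
    linarith

lemma condMutualInfo_eq_sub {p : Ω → ℝ} (hp : ∀ ω, 0 ≤ p ω) (f : Ω → α) (g : Ω → β) (h : Ω → γ) :
    condMutualInfo p f g h = condEntropy p f h - condEntropy p f (fun ω => (g ω, h ω)) := by
  rw [condMutualInfo_eq_expect, condEntropy_eq_expect, condEntropy_eq_expect, ← expect_sub]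
  refine expect_congr fun ω hω => ?_
  have h₁ := law_pos hp h hω
  have h₂ := law_pos hp (fun ω => (f ω, h ω)) hω
  have h₃ := law_pos hp (fun ω => (g ω, h ω)) hω
  have h₄ := law_pos hp (fun ω => (f ω, g ω, h ω)) hω
  rw [neg_sub_neg, ← logb_div (by positivity) (by positivity)]
  congr 1
  field_simp

lemma condMutualInfo_nonneg {p : Ω → ℝ} (hp : ∀ ω, 0 ≤ p ω) (f : Ω → α) (g : Ω → β)
    (h : Ω → γ) : 0 ≤ condMutualInfo p f g h := by
  rw [condMutualInfo_eq_sub hp, sub_nonneg]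
  exact condEntropy_le_of_factorsThrough hp f fun ω ω' hω => congrArg Prod.snd hω

lemma condEntropy_pi {n : ℕ} {p : Ω → ℝ} (hp : ∀ ω, 0 ≤ p ω) (f : Fin n → Ω → α) (g : Ω → β) :
    condEntropy p (fun ω i => f i ω) g
      = ∑ i, condEntropy p (f i) fun ω => ((fun j : {j // j < i} => f j ω), g ω) := by
  induction n with
  | zero =>
    rw [Fin.sum_univ_zero, condEntropy_eq_expect, expect]
    refine sum_eq_zero fun ω _ => ?_
    rw [law_congr p (f := fun ω => ((fun i : Fin 0 => f i ω), g ω)) (g := g) (b := g ω) fun ω' => by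
      simp only [Prod.mk.injEq, and_iff_right (Subsingleton.elim _ _)]]
    rcases eq_or_ne (law p g (g ω)) 0 with h | h <;> simp [h]
  | succ n ih =>
    have hsplit : condEntropy p (fun ω i => f i ω) g
        = condEntropy p (fun ω => (f (Fin.last n) ω, fun i : Fin n => f i.castSucc ω)) g :=
      condEntropy_congr p (fun _ _ => Iff.rfl) fun ω ω' _ => by
        simp only [funext_iff, Prod.mk.injEq, Fin.forall_fin_succ', and_comm]
    rw [hsplit, condEntropy_prodMk hp, ih fun i => f i.castSucc, Fin.sum_univ_castSucc]
    congr 1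
    · refine sum_congr rfl fun i _ => condEntropy_congr p (fun ω ω' => ?_) fun _ _ _ => Iff.rfl
      simp only [Prod.mk.injEq, funext_iff, Subtype.forall, Fin.forall_fin_succ',
        Fin.castSucc_lt_castSucc_iff, (Fin.castSucc_lt_last i).not_gt, false_imp_iff, and_true]
    · refine condEntropy_congr p (fun ω ω' => ?_) fun _ _ _ => Iff.rfl
      simp only [Prod.mk.injEq, funext_iff, Subtype.forall, Fin.forall_fin_succ',
        Fin.castSucc_lt_last, true_imp_iff, lt_irrefl, false_imp_iff, and_true]

lemma condEntropy_le_condEntropy_prodMk_add_logb_card {p : Ω → ℝ} (hp : p ∈ stdSimplex ℝ Ω)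
    (f : Ω → α) (g : Ω → β) (h : Ω → γ) :
    condEntropy p f h ≤ condEntropy p f (fun ω => (g ω, h ω)) + logb 2 (Fintype.card β) := by
  have hswap : condEntropy p (fun ω => (g ω, f ω)) h = condEntropy p (fun ω => (f ω, g ω)) h :=
    condEntropy_congr p (fun _ _ => Iff.rfl) fun _ _ _ => by simp only [Prod.mk.injEq, and_comm]
  have hgf := condEntropy_prodMk hp.1 g f h
  have hfg := condEntropy_prodMk hp.1 f g h
  linarith [condEntropy_nonneg hp.1 g fun ω => (f ω, h ω), condEntropy_le_logb_card hp g h]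

lemma condEntropy_eq_condEntropy_comp_add {p : Ω → ℝ} (hp : ∀ ω, 0 ≤ p ω) (f : Ω → α) (e : α → δ)
    (h : Ω → γ) : condEntropy p f h
      = condEntropy p (fun ω => e (f ω)) h + condEntropy p f fun ω => (e (f ω), h ω) := by
  rw [← condEntropy_prodMk hp]
  exact condEntropy_congr p (fun _ _ => Iff.rfl) fun ω ω' _ => by
    simp only [Prod.mk.injEq, iff_self_and]
    exact congrArg e

lemma condMutualInfo_comp_left_le {p : Ω → ℝ} (hp : ∀ ω, 0 ≤ p ω) (f : Ω → α) (e : α → δ)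
    (g : Ω → β) (h : Ω → γ) :
    condMutualInfo p (fun ω => e (f ω)) g h ≤ condMutualInfo p f g h := by
  have hmono : condEntropy p f (fun ω => (e (f ω), g ω, h ω))
      ≤ condEntropy p f fun ω => (e (f ω), h ω) :=
    condEntropy_le_of_factorsThrough hp f fun ω ω' hω => by
      simp only [Prod.mk.injEq] at hω ⊢
      exact ⟨hω.1, hω.2.2⟩
  rw [condMutualInfo_eq_sub hp, condMutualInfo_eq_sub hp]
  linarith [condEntropy_eq_condEntropy_comp_add hp f e h,
    condEntropy_eq_condEntropy_comp_add hp f e fun ω => (g ω, h ω)]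

end Information

section Concentration

variable {ι α : Type*} [Fintype ι] [DecidableEq ι] [Fintype α]

lemma expect_piPmf_sum_sq {p : α → ℝ} (hp : p ∈ stdSimplex ℝ α) {g : α → ℝ}
    (hg : expect p g = 0) :
    expect (piPmf fun _ : ι => p) (fun s => (∑ i, g (s i)) ^ 2)
      = Fintype.card ι * expect p fun a => g a ^ 2 := by
  have hdiag : ∀ i j : ι, expect (piPmf fun _ : ι => p) (fun s => g (s i) * g (s j))
      = if i = j then expect p fun a => g a ^ 2 else 0 := by
    intro i j
    split_ifs with hij
    · simp only [hij, ← sq, expect_piPmf_apply (fun _ => hp) j fun a => g a ^ 2]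
    · rw [expect_piPmf_apply_mul_apply (fun _ => hp) hij g g, hg, zero_mul]
  simp only [sq (∑ _, _), sum_mul_sum, expect_sum, hdiag, sum_ite_eq, mem_univ, if_true,
    sum_const, card_univ, nsmul_eq_mul]

lemma eventually_prob_iid_le {p : α → ℝ} (hp : p ∈ stdSimplex ℝ α) {r : α → ℝ}
    (hr : ∀ a, p a ≠ 0 → 0 < r a) {μ : ℝ} (hμ : expect p (fun a => logb 2 (r a)) = μ)
    {δ η : ℝ} (hδ : 0 < δ) (hη : 0 < η) :
    ∀ᶠ n : ℕ in atTop, prob (iid n p) (fun s => ∏ i, r (s i) ≤ 2 ^ (n * (μ - δ))) ≤ η := by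
  set g : α → ℝ := fun a => logb 2 (r a) - μ
  have hg : expect p g = 0 := by rw [expect_sub, expect_const hp, hμ, sub_self]
  set σ := expect p fun a => g a ^ 2
  obtain ⟨N, hN⟩ := exists_nat_gt (σ / (η * δ ^ 2))
  filter_upwards [eventually_gt_atTop N] with n hn
  have hn0 : (0 : ℝ) < n := Nat.cast_pos.2 (by lia)
  have hσ : σ ≤ n * (η * δ ^ 2) :=
    ((div_lt_iff₀ (by positivity)).1 (hN.trans_le (Nat.cast_le.2 (by lia)))).le
  have hdev : ∀ s : Fin n → α, iid n p s ≠ 0 →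
      ∏ i, r (s i) ≤ 2 ^ (n * (μ - δ)) → n * δ ≤ -∑ i, g (s i) := by
    intro s hs hle
    have hpos : ∀ i, 0 < r (s i) := fun i => hr _ (ne_zero_of_piPmf_ne_zero hs i)
    rw [← logb_le_iff_le_rpow one_lt_two (prod_pos fun i _ => hpos i),
      logb_prod _ (fun i => r (s i)) fun i _ => (hpos i).ne'] at hle
    simp only [g, sum_sub_distrib, sum_const, card_univ, Fintype.card_fin, nsmul_eq_mul]
    linarith
  calc prob (iid n p) (fun s => ∏ i, r (s i) ≤ 2 ^ (n * (μ - δ)))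
      ≤ expect (iid n p) fun s => (∑ i, g (s i)) ^ 2 * ((n * δ) ^ 2)⁻¹ := by
        refine expect_mono (piPmf_mem_stdSimplex fun _ => hp).1 fun s hs =>
          ind_le (by positivity) fun hle => ?_
        rw [← div_eq_mul_inv, one_le_div (by positivity), ← neg_sq (∑ i, _)]
        exact pow_le_pow_left₀ (by positivity) (hdev s hs hle) 2
    _ = n * σ / (n * δ) ^ 2 := by
        rw [expect_mul_const, expect_piPmf_sum_sq hp hg, Fintype.card_fin, div_eq_mul_inv]
    _ ≤ η := by
        rw [div_le_iff₀ (by positivity)]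
        calc n * σ ≤ n * (n * (η * δ ^ 2)) := by gcongr
          _ = η * (n * δ) ^ 2 := by ring

lemma expect_sub_expect_sq_le {p : α → ℝ} (hp : p ∈ stdSimplex ℝ α) {f : α → ℝ} {γ : ℝ}
    (hf : ∀ a, 0 ≤ f a) (hfγ : ∀ a, f a ≤ γ) (hf1 : expect p f ≤ 1) (hγ : 0 ≤ γ) :
    expect p (fun a => (f a - expect p f) ^ 2) ≤ γ := by
  have hsq : expect p (fun a => f a ^ 2) ≤ γ := by
    calc expect p (fun a => f a ^ 2) ≤ expect p fun a => γ * f a :=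
          expect_mono hp.1 fun a _ => by
            rw [sq]; exact mul_le_mul_of_nonneg_right (hfγ a) (hf a)
      _ ≤ γ := by rw [expect_const_mul]; exact mul_le_of_le_one_right hγ hf1
  have hexp : expect p (fun a => (f a - expect p f) ^ 2)
      = expect p (fun a => f a ^ 2) - expect p f ^ 2 := by
    simp only [sub_sq, expect_add, expect_sub, expect_mul_const, expect_const_mul,
      expect_const hp, mul_assoc]
    ring
  linarith [sq_nonneg (expect p f)]

lemma expect_abs_sub_mean_le {p : α → ℝ} (hp : p ∈ stdSimplex ℝ α) {f : α → ℝ} {γ s : ℝ}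
    (hf : ∀ a, 0 ≤ f a) (hfγ : ∀ a, f a ≤ γ) (hf1 : expect p f ≤ 1) (hγ0 : 0 ≤ γ) (hs : 0 < s)
    (hγ : γ ≤ s ^ 2 * Fintype.card ι) [Nonempty ι] :
    expect (piPmf fun _ : ι => p) (fun c => |expect p f - (Fintype.card ι : ℝ)⁻¹ * ∑ j, f (c j)|)
      ≤ s := by
  set m := expect p f
  set N : ℝ := (Fintype.card ι : ℝ)
  have hN : 0 < N := Nat.cast_pos.2 Fintype.card_pos
  have hg : expect p (fun a => f a - m) = 0 := by rw [expect_sub, expect_const hp, sub_self]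
  have hvar : expect p (fun a => (f a - m) ^ 2) ≤ γ := expect_sub_expect_sq_le hp hf hfγ hf1 hγ0
  have hpt : ∀ c : ι → α, |m - N⁻¹ * ∑ j, f (c j)|
      ≤ s / 2 + (∑ j, (f (c j) - m)) ^ 2 * (2 * s * N ^ 2)⁻¹ := by
    intro c
    have hz : m - N⁻¹ * ∑ j, f (c j) = -((∑ j, (f (c j) - m)) / N) := by
      rw [sum_sub_distrib, sum_const, card_univ, nsmul_eq_mul]
      field_simp
      ring
    have hrhs : (∑ j, (f (c j) - m)) ^ 2 * (2 * s * N ^ 2)⁻¹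
        = |(∑ j, (f (c j) - m)) / N| ^ 2 / (2 * s) := by
      rw [sq_abs]
      field_simp
    rw [hz, abs_neg, hrhs, ← sub_nonneg]
    set z := |(∑ j, (f (c j) - m)) / N|
    have : s / 2 + z ^ 2 / (2 * s) - z = (z - s) ^ 2 / (2 * s) := by
      field_simp
      ring
    rw [this]
    positivity
  refine (expect_mono (piPmf_mem_stdSimplex fun _ => hp).1 fun c _ => hpt c).trans ?_
  rw [expect_add, expect_const (piPmf_mem_stdSimplex fun _ => hp), expect_mul_const,
    expect_piPmf_sum_sq hp hg]
  suffices N * expect p (fun a => (f a - m) ^ 2) * (2 * s * N ^ 2)⁻¹ ≤ s / 2 by linarith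
  rw [← div_eq_mul_inv, div_le_iff₀ (by positivity)]
  calc N * expect p (fun a => (f a - m) ^ 2) ≤ N * (s ^ 2 * N) := by
        gcongr; exact hvar.trans hγ
    _ = s / 2 * (2 * s * N ^ 2) := by ring

lemma expect_abs_one_sub_mean_le {p : α → ℝ} (hp : p ∈ stdSimplex ℝ α) {f : α → ℝ}
    (hf : ∀ a, 0 ≤ f a) (hf1 : expect p f = 1) {γ s : ℝ} (hγ0 : 0 ≤ γ) (hs : 0 < s)
    (hγ : γ ≤ s ^ 2 * Fintype.card ι) [Nonempty ι] :
    expect (piPmf fun _ : ι => p) (fun c => |1 - (Fintype.card ι : ℝ)⁻¹ * ∑ j, f (c j)|)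
      ≤ s + 2 * expect p fun a => f a * ind (γ < f a) := by
  set N : ℝ := (Fintype.card ι : ℝ)
  have hN : N ≠ 0 := Nat.cast_ne_zero.2 Fintype.card_ne_zero
  set big : α → ℝ := fun a => f a * ind (γ < f a)
  set small : α → ℝ := fun a => f a - big a
  have hbig : ∀ a, 0 ≤ big a := fun a => mul_nonneg (hf a) (ind_nonneg _)
  have hsmall : ∀ a, 0 ≤ small a ∧ small a ≤ γ := by
    intro a
    by_cases h : γ < f a
    · simp [small, big, ind_of h, hγ0]
    · simpa [small, big, ind_of_not h] using ⟨hf a, not_lt.1 h⟩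
  have hmean : expect p small = 1 - expect p big := by rw [expect_sub, hf1]
  have hbig0 : 0 ≤ expect p big := expect_nonneg hp.1 hbig
  have hcov := expect_abs_sub_mean_le (ι := ι) hp (fun a => (hsmall a).1) (fun a => (hsmall a).2)
    (by linarith) hγ0 hs hγ
  have hpt : ∀ c : ι → α, |1 - N⁻¹ * ∑ j, f (c j)|
      ≤ |expect p small - N⁻¹ * ∑ j, small (c j)| + (expect p big + ∑ j, N⁻¹ * big (c j)) := by
    intro c
    have hsplit : 1 - N⁻¹ * ∑ j, f (c j) = (expect p small - N⁻¹ * ∑ j, small (c j))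
        + (expect p big - ∑ j, N⁻¹ * big (c j)) := by
      rw [hmean, ← mul_sum, sum_sub_distrib]
      ring
    have hpos : 0 ≤ ∑ j, N⁻¹ * big (c j) :=
      sum_nonneg fun j _ => mul_nonneg (by positivity) (hbig _)
    rw [hsplit]
    refine (abs_add_le _ _).trans (add_le_add_right ((abs_sub _ _).trans_eq ?_) _)
    rw [abs_of_nonneg hbig0, abs_of_nonneg hpos]
  refine (expect_mono (piPmf_mem_stdSimplex fun _ => hp).1 fun c _ => hpt c).trans ?_
  have hempirical : expect (piPmf fun _ : ι => p) (fun c => ∑ j, N⁻¹ * big (c j))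
      = expect p big := by
    simp only [expect_sum, expect_const_mul, expect_piPmf_apply (fun _ => hp), sum_const,
      card_univ, nsmul_eq_mul]
    exact mul_inv_cancel_left₀ hN _
  rw [expect_add, expect_add, expect_const (piPmf_mem_stdSimplex fun _ => hp), hempirical]
  linarith

end Concentration

section Density

variable {Ω S V A : Type*} [Fintype Ω]

/-- The likelihood ratio `p(a,b) / (p(a) p(b))`, whose logarithm is the information density of `f`
and `g`; it is `0` where `p(a) p(b) = 0`. -/
def infoDensity (p : Ω → ℝ) (f : Ω → V) (g : Ω → A) (v : V) (a : A) : ℝ :=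
  law p (fun ω => (f ω, g ω)) (v, a) / (law p f v * law p g a)

/-- The conditional pmf of `f` given `g`; it is `0` where `g` has probability `0`. -/
def condLaw (p : Ω → ℝ) (f : Ω → V) (g : Ω → A) (v : V) (a : A) : ℝ :=
  law p (fun ω => (f ω, g ω)) (v, a) / law p g a

lemma law_le_law {p : Ω → ℝ} (hp : ∀ ω, 0 ≤ p ω) {f : Ω → V} {g : Ω → A} {v : V} {a : A}
    (h : ∀ ω, f ω = v → g ω = a) : law p f v ≤ law p g a := by
  rw [law_eq_prob, law_eq_prob]
  exact prob_mono hp fun ω _ => h ω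

lemma law_prodMk_eq_zero_of_right {p : Ω → ℝ} (hp : ∀ ω, 0 ≤ p ω) {f : Ω → V} {g : Ω → A}
    (v : V) {a : A} (h : law p g a = 0) : law p (fun ω => (f ω, g ω)) (v, a) = 0 :=
  le_antisymm ((law_le_law hp fun _ hω => congrArg Prod.snd hω).trans_eq h) (law_nonneg hp _ _)

lemma law_prodMk_eq_zero_of_left {p : Ω → ℝ} (hp : ∀ ω, 0 ≤ p ω) {f : Ω → V} {g : Ω → A}
    {v : V} (a : A) (h : law p f v = 0) : law p (fun ω => (f ω, g ω)) (v, a) = 0 :=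
  le_antisymm ((law_le_law hp fun _ hω => congrArg Prod.fst hω).trans_eq h) (law_nonneg hp _ _)

lemma infoDensity_nonneg {p : Ω → ℝ} (hp : ∀ ω, 0 ≤ p ω) (f : Ω → V) (g : Ω → A) (v : V)
    (a : A) : 0 ≤ infoDensity p f g v a :=
  div_nonneg (law_nonneg hp _ _) (mul_nonneg (law_nonneg hp _ _) (law_nonneg hp _ _))

lemma infoDensity_pos {p : Ω → ℝ} (hp : ∀ ω, 0 ≤ p ω) (f : Ω → V) (g : Ω → A) {ω : Ω}
    (hω : p ω ≠ 0) : 0 < infoDensity p f g (f ω) (g ω) :=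
  div_pos (law_pos hp (fun ω => (f ω, g ω)) hω) (mul_pos (law_pos hp f hω) (law_pos hp g hω))

lemma condLaw_pos {p : Ω → ℝ} (hp : ∀ ω, 0 ≤ p ω) (f : Ω → V) (g : Ω → A) {ω : Ω}
    (hω : p ω ≠ 0) : 0 < condLaw p f g (f ω) (g ω) :=
  div_pos (law_pos hp (fun ω => (f ω, g ω)) hω) (law_pos hp g hω)

lemma infoDensity_swap (p : Ω → ℝ) (f : Ω → V) (g : Ω → A) (v : V) (a : A) :
    infoDensity p f g v a = infoDensity p g f a v := by
  rw [infoDensity, infoDensity, law_prodMk_swap, mul_comm]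

lemma law_mul_infoDensity {p : Ω → ℝ} (hp : ∀ ω, 0 ≤ p ω) (f : Ω → V) (g : Ω → A) (v : V)
    (a : A) : law p g a * infoDensity p f g v a = condLaw p g f a v := by
  rw [infoDensity, condLaw, ← law_prodMk_swap]
  rcases eq_or_ne (law p g a) 0 with h | h
  · simp [h, law_prodMk_eq_zero_of_left hp v h]
  · field_simp

lemma sum_condLaw_le_one [Fintype V] (p : Ω → ℝ) (f : Ω → V) (g : Ω → A) (a : A) :
    ∑ v, condLaw p f g v a ≤ 1 := by
  simp only [condLaw, ← sum_div, law_snd_eq_sum]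
  exact div_self_le_one _

lemma sum_condLaw [Fintype V] {p : Ω → ℝ} (hp : ∀ ω, 0 ≤ p ω) (f : Ω → V) (g : Ω → A) {ω : Ω}
    (hω : p ω ≠ 0) : ∑ v, condLaw p f g v (g ω) = 1 := by
  simp only [condLaw, ← sum_div, law_snd_eq_sum]
  exact div_self (law_pos hp g hω).ne'

lemma sum_ind_lt_condLaw_le [Fintype V] {p : Ω → ℝ} (hp : ∀ ω, 0 ≤ p ω) (f : Ω → V) (g : Ω → A)
    {θ : ℝ} (hθ : 0 < θ) (a : A) : ∑ v, ind (θ < condLaw p f g v a) ≤ 1 / θ := by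
  have hmarkov : ∀ v, ind (θ < condLaw p f g v a) ≤ condLaw p f g v a / θ := fun v =>
    ind_le (div_nonneg (div_nonneg (law_nonneg hp _ _) (law_nonneg hp _ _)) hθ.le) fun h =>
      (one_le_div hθ).2 h.le
  refine (sum_le_sum fun v _ => hmarkov v).trans ?_
  rw [← sum_div]
  exact div_le_div_of_nonneg_right (sum_condLaw_le_one p f g a) hθ.le

variable [Fintype A]

lemma expect_law_infoDensity {p : Ω → ℝ} (hp : ∀ ω, 0 ≤ p ω) (f : Ω → V) (g : Ω → A) {ω : Ω}
    (hω : p ω ≠ 0) : expect (law p g) (infoDensity p f g (f ω)) = 1 := by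
  simp only [expect, law_mul_infoDensity hp, sum_condLaw hp g f hω]

lemma expect_prob_lt_infoDensity_le {p : Ω → ℝ} (hp : p ∈ stdSimplex ℝ Ω) (f : Ω → V)
    (g : Ω → A) {γ : ℝ} (hγ : 0 < γ) :
    expect p (fun ω => prob (law p g) fun a => γ < infoDensity p f g (f ω) a) ≤ 1 / γ := by
  rw [← expect_const hp (1 / γ)]
  refine expect_mono hp.1 fun ω hω => ?_
  have hmarkov : ∀ a, ind (γ < infoDensity p f g (f ω) a) ≤ infoDensity p f g (f ω) a * γ⁻¹ :=
    fun a => by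
      refine ind_le (mul_nonneg (infoDensity_nonneg hp.1 f g _ _) (by positivity)) fun h => ?_
      rw [← div_eq_mul_inv, one_le_div hγ]
      exact h.le
  refine (expect_mono (law_nonneg hp.1 g) fun a _ => hmarkov a).trans_eq ?_
  rw [expect_mul_const, expect_law_infoDensity hp.1 f g hω, one_div, one_mul]

lemma expect_infoDensity_mul [Finite S] [Finite V] {p : Ω → ℝ} (hp : ∀ ω, 0 ≤ p ω) {s : Ω → S}
    {v : Ω → V} {a : Ω → A} (hM : IsMarkovChain p s v a) (F : S → V → A → ℝ) :
    expect p (fun ω => expect (law p a) fun a' => infoDensity p v a (v ω) a' * F (s ω) (v ω) a')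
      = expect p fun ω => F (s ω) (v ω) (a ω) := by
  have := Fintype.ofFinite S
  have := Fintype.ofFinite V
  have hdisint : ∀ s' v' a', law p (fun ω => (s ω, v ω)) (s', v') * condLaw p a v a' v'
      = law p (fun ω => (s ω, v ω, a ω)) (s', v', a') := by
    intro s' v' a'
    rcases eq_or_ne (law p v v') 0 with h | h
    · rw [law_prodMk_eq_zero_of_right hp _ h, zero_mul, eq_comm]
      exact law_prodMk_eq_zero_of_right hp _ (law_prodMk_eq_zero_of_left hp _ h)
    · rw [condLaw, law_prodMk_swap p a v, ← mul_div_assoc, ← hM, mul_div_cancel_right₀ _ h]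
  rw [← expect_law p (fun ω => (s ω, v ω)) fun z => expect (law p a) fun a' =>
    infoDensity p v a z.2 a' * F z.1 z.2 a', ← expect_law p (fun ω => (s ω, v ω, a ω)) fun z =>
    F z.1 z.2.1 z.2.2]
  simp only [expect, Fintype.sum_prod_type, mul_sum, ← hdisint, ← law_mul_infoDensity hp v a,
    mul_assoc]

end Density

section Helper

variable {Ω S V A M L J : Type*} [Fintype Ω] [Fintype A] [Fintype M] [Fintype L] [Fintype J]

lemma sum_ind_ne (l : L) : ∑ l', ind (l' ≠ l) = Fintype.card L - 1 := by
  classical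
  rw [← add_sum_erase univ _ (mem_univ l), ind_of_not (not_not.2 rfl), zero_add,
    sum_congr rfl fun l' hl' => ind_of (ne_of_mem_erase hl'), sum_const, nsmul_one,
    card_erase_of_mem (mem_univ l), card_univ, Nat.cast_pred (Fintype.card_pos_iff.2 ⟨l⟩)]

lemma expect_codebook_collision [DecidableEq M] [DecidableEq L] [Nonempty M] [Nonempty L]
    {p : Ω → ℝ} (hp : p ∈ stdSimplex ℝ Ω) (v : Ω → V) (a : Ω → A) (G : Ω → A → ℝ) :
    expect (piPmf fun _ : M × L => law p a) (fun c => expect p fun ω =>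
        ∑ j, (Fintype.card (M × L) : ℝ)⁻¹ * infoDensity p v a (v ω) (c j) *
          ∑ l, ind (l ≠ j.2) * G ω (c (j.1, l)))
      = (Fintype.card L - 1) * expect p fun ω => expect (law p a) (G ω) := by
  have hpA := law_mem_stdSimplex hp a
  rw [expect_comm, ← expect_const_mul]
  refine expect_congr fun ω hω => ?_
  have hpair : ∀ (j : M × L) (l : L), expect (piPmf fun _ : M × L => law p a) (fun c =>
      infoDensity p v a (v ω) (c j) * (ind (l ≠ j.2) * G ω (c (j.1, l))))
      = ind (l ≠ j.2) * expect (law p a) (G ω) := by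
    intro j l
    simp only [mul_left_comm _ (ind _), expect_const_mul]
    by_cases hl : l = j.2
    · rw [ind_of_not (not_not.2 hl), zero_mul, zero_mul]
    · rw [expect_piPmf_apply_mul_apply (fun _ => hpA)
        (fun h => hl (congrArg Prod.snd h).symm), expect_law_infoDensity hp.1 v a hω, one_mul]
  have hN : (Fintype.card (M × L) : ℝ) ≠ 0 := Nat.cast_ne_zero.2 Fintype.card_ne_zero
  simp only [expect_sum, mul_assoc, expect_const_mul, mul_sum]
  simp only [hpair, ← mul_sum, ← sum_mul, sum_ind_ne, sum_const, card_univ, nsmul_eq_mul]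
  field_simp

lemma expect_eq_sum_expect_ind [Fintype V] (p : Ω → ℝ) (v : Ω → V) (F : Ω → V → ℝ) :
    expect p (fun ω => F ω (v ω)) = ∑ v', expect p fun ω => ind (v ω = v') * F ω v' := by
  classical
  rw [← expect_sum]
  simp [ind]

lemma exists_index_expect_le [Finite V] [Nonempty J] {p : Ω → ℝ} (hp : ∀ ω, 0 ≤ p ω) (v : Ω → V)
    {e : Ω → J → ℝ} (he0 : ∀ ω j, 0 ≤ e ω j) (he1 : ∀ ω j, e ω j ≤ 1) {ψ : V → J → ℝ}
    (hψ : ∀ v j, 0 ≤ ψ v j) :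
    ∃ b : V → J, expect p (fun ω => e ω (b (v ω)))
      ≤ expect p (fun ω => ∑ j, ψ (v ω) j * e ω j) + expect p fun ω => |1 - ∑ j, ψ (v ω) j| := by
  have := Fintype.ofFinite V
  set E : V → J → ℝ := fun v' j => expect p fun ω => ind (v ω = v') * e ω j
  choose b hb using fun v' => Finite.exists_min (E v')
  refine ⟨b, ?_⟩
  rw [expect_eq_sum_expect_ind p v fun ω v' => e ω (b v'),
    expect_eq_sum_expect_ind p v fun ω v' => ∑ j, ψ v' j * e ω j,
    expect_eq_sum_expect_ind p v fun ω v' => |1 - ∑ j, ψ v' j|, ← sum_add_distrib]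
  refine sum_le_sum fun v' _ => ?_
  have hmean : (∑ j, ψ v' j) * E v' (b v')
      ≤ expect p fun ω => ind (v ω = v') * ∑ j, ψ v' j * e ω j := by
    simp only [mul_sum, mul_left_comm _ (ψ v' _), expect_sum, expect_const_mul, sum_mul]
    exact sum_le_sum fun j _ => mul_le_mul_of_nonneg_left (hb v' j) (hψ v' j)
  have hdefect : (1 - ∑ j, ψ v' j) * E v' (b v')
      ≤ expect p fun ω => ind (v ω = v') * |1 - ∑ j, ψ v' j| := by
    rw [← expect_const_mul]
    refine expect_mono hp fun ω _ => ?_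
    rw [mul_left_comm]
    refine mul_le_mul_of_nonneg_left ?_ (ind_nonneg _)
    calc (1 - ∑ j, ψ v' j) * e ω (b v') ≤ |1 - ∑ j, ψ v' j| * e ω (b v') :=
          mul_le_mul_of_nonneg_right (le_abs_self _) (he0 _ _)
      _ ≤ |1 - ∑ j, ψ v' j| := mul_le_of_le_one_right (abs_nonneg _) (he1 _ _)
  linarith

variable [Finite S] [Finite V]

lemma expect_codebook_infoDensity_mul [DecidableEq J] [Nonempty J] {p : Ω → ℝ}
    (hp : p ∈ stdSimplex ℝ Ω) {s : Ω → S} {v : Ω → V} {a : Ω → A} (hM : IsMarkovChain p s v a)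
    (F : S → A → ℝ) :
    expect (piPmf fun _ : J => law p a) (fun c => expect p fun ω =>
        ∑ j, (Fintype.card J : ℝ)⁻¹ * infoDensity p v a (v ω) (c j) * F (s ω) (c j))
      = expect p fun ω => F (s ω) (a ω) := by
  rw [expect_comm, ← expect_infoDensity_mul hp.1 hM fun s _ a => F s a]
  refine expect_congr fun ω _ => ?_
  simp only [expect_sum, mul_assoc, expect_const_mul]
  simp only [expect_piPmf_apply (fun _ => law_mem_stdSimplex hp a) _ fun a' =>
    infoDensity p v a (v ω) a' * F (s ω) a', sum_const, card_univ, nsmul_eq_mul]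
  exact mul_inv_cancel_left₀ (Nat.cast_ne_zero.2 Fintype.card_ne_zero) _

/-- The helper quantizes `v` to a word of an iid codebook and announces only its bin `m`; the
hypothesis `herr` is a union bound over the words `c (m, l)` of the bin. -/
lemma exists_binning [Nonempty M] [Nonempty L] {p : Ω → ℝ} (hp : p ∈ stdSimplex ℝ Ω)
    {s : Ω → S} {v : Ω → V} {a : Ω → A} (hM : IsMarkovChain p s v a)
    {err : (M × L → A) → Ω → M → ℝ} (herr0 : ∀ c ω m, 0 ≤ err c ω m)
    (herr1 : ∀ c ω m, err c ω m ≤ 1) {F G : S → A → ℝ}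
    (herr : ∀ c ω m l, err c ω m
      ≤ F (s ω) (c (m, l)) + ∑ l', ind (l' ≠ l) * G (s ω) (c (m, l')))
    {γ σ : ℝ} (hγ0 : 0 ≤ γ) (hσ : 0 < σ) (hγ : γ ≤ σ ^ 2 * Fintype.card (M × L)) :
    ∃ (c : M × L → A) (helper : V → M), expect p (fun ω => err c ω (helper (v ω)))
      ≤ expect p (fun ω => F (s ω) (a ω))
        + (Fintype.card L - 1) * expect p (fun ω => expect (law p a) (G (s ω)))
        + (σ + 2 * prob p fun ω => γ < infoDensity p v a (v ω) (a ω)) := by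
  classical
  set N : ℝ := (Fintype.card (M × L) : ℝ)
  have hcode : (piPmf fun _ : M × L => law p a) ∈ stdSimplex ℝ (M × L → A) :=
    piPmf_mem_stdSimplex fun _ => law_mem_stdSimplex hp a
  have hN : 0 ≤ N⁻¹ := by positivity
  set ψ : (M × L → A) → V → M × L → ℝ := fun c v' j => N⁻¹ * infoDensity p v a v' (c j)
  have hψ : ∀ c v' j, 0 ≤ ψ c v' j := fun c v' j =>
    mul_nonneg hN (infoDensity_nonneg hp.1 v a _ _)
  have hbin : expect (piPmf fun _ : M × L => law p a) (fun c =>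
      expect p fun ω => ∑ j, ψ c (v ω) j * err c ω j.1)
      ≤ expect p (fun ω => F (s ω) (a ω))
        + (Fintype.card L - 1) * expect p (fun ω => expect (law p a) (G (s ω))) := by
    rw [← expect_codebook_infoDensity_mul (J := M × L) hp hM F]
    rw [← expect_codebook_collision (M := M) hp v a fun ω => G (s ω)]
    simp only [← expect_add, ← sum_add_distrib, ← mul_add]
    exact expect_mono hcode.1 fun c _ => expect_mono hp.1 fun ω _ => sum_le_sum fun j _ =>
      mul_le_mul_of_nonneg_left (herr c ω j.1 j.2) (hψ c _ j)
  have hcover : expect (piPmf fun _ : M × L => law p a) (fun c =>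
      expect p fun ω => |1 - ∑ j, ψ c (v ω) j|)
      ≤ σ + 2 * prob p fun ω => γ < infoDensity p v a (v ω) (a ω) := by
    rw [prob, ← expect_infoDensity_mul hp.1 hM fun _ v' a' => ind (γ < infoDensity p v a v' a'),
      expect_comm, ← expect_const hp σ, ← expect_const_mul, ← expect_add]
    refine expect_mono hp.1 fun ω hω => ?_
    simp only [ψ, ← mul_sum]
    exact expect_abs_one_sub_mean_le (law_mem_stdSimplex hp a)
      (infoDensity_nonneg hp.1 v a (v ω)) (expect_law_infoDensity hp.1 v a hω) hγ0 hσ hγ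
  obtain ⟨c, hc⟩ := exists_le_of_expect_le hcode
    ((expect_add _ _ _).trans_le (add_le_add hbin hcover))
  obtain ⟨b, hb⟩ := exists_index_expect_le hp.1 v (fun ω (j : M × L) => herr0 c ω j.1)
    (fun ω j => herr1 c ω j.1) (hψ c)
  exact ⟨c, fun v' => (b v').1, hb.trans hc⟩

end Helper

section OneShot

variable {Ω X Y V A W U M L : Type*}

open Classical in
lemma exists_typicality_decoder [Nonempty X] (G₁ : A → Y → Prop) (G₂ : X → A → Y → Prop)
    (G₃ : W → U → Prop) (enc : X → W) (c : M × L → A) :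
    ∃ dec : U → Y → M → X, ∀ u y x m l, dec u y m ≠ x →
      (¬G₁ (c (m, l)) y ∨ ¬G₂ x (c (m, l)) y) ∨ (¬G₃ (enc x) u ∨
        ∃ x', x' ≠ x ∧ G₂ x' (c (m, l)) y ∧ G₃ (enc x') u) ∨
      ∃ l', l' ≠ l ∧ G₁ (c (m, l')) y := by
  let good (u : U) (y : Y) (m : M) (x : X) : Prop :=
    ∃ l, G₁ (c (m, l)) y ∧ G₂ x (c (m, l)) y ∧ G₃ (enc x) u
  refine ⟨fun u y m => if h : ∃ x, good u y m x then h.choose else Classical.arbitrary X,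
    fun u y x m l hne => ?_⟩
  by_contra! hc
  obtain ⟨⟨h₁, h₂⟩, ⟨h₃, hx⟩, hl⟩ := hc
  have hex : ∃ x, good u y m x := ⟨x, l, h₁, h₂, h₃⟩
  simp only [dif_pos hex] at hne
  obtain ⟨l', g₁, g₂, g₃⟩ := hex.choose_spec
  obtain rfl : l' = l := by_contra fun h => hl l' h g₁
  exact hx _ hne g₂ g₃

variable [Fintype Ω] [Fintype U]

/-- The error probability of a receiver that decodes `x` from the output of the channel `t`, its
side information `y` and the message of a helper that observes `v`. -/
def codeError (p : Ω → ℝ) (x : Ω → X) (y : Ω → Y) (v : Ω → V) (t : W → U → ℝ) (enc : X → W)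
    (helper : V → M) (dec : U → Y → M → X) : ℝ :=
  prob (jointPmf p fun ω => t (enc (x ω))) fun z => dec z.2 (y z.1) (helper (v z.1)) ≠ x z.1

/-- The error probability of the best helper with messages in `M` and the best decoder, for a given
encoder. -/
def optError (M : Type*) (p : Ω → ℝ) (x : Ω → X) (y : Ω → Y) (v : Ω → V) (t : W → U → ℝ)
    (enc : X → W) : ℝ :=
  ⨅ c : (V → M) × (U → Y → M → X), codeError p x y v t enc c.1 c.2

lemma codeError_eq_expect (p : Ω → ℝ) (x : Ω → X) (y : Ω → Y) (v : Ω → V) (t : W → U → ℝ)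
    (enc : X → W) (helper : V → M) (dec : U → Y → M → X) :
    codeError p x y v t enc helper dec
      = expect p fun ω => prob (t (enc (x ω))) fun u => dec u (y ω) (helper (v ω)) ≠ x ω :=
  expect_jointPmf _ _ _

lemma optError_nonneg {p : Ω → ℝ} (hp : ∀ ω, 0 ≤ p ω) (x : Ω → X) (y : Ω → Y) (v : Ω → V)
    {t : W → U → ℝ} (ht : ∀ w u, 0 ≤ t w u) (enc : X → W) : 0 ≤ optError M p x y v t enc :=
  Real.iInf_nonneg fun _ => prob_nonneg (fun _ => mul_nonneg (hp _) (ht _ _)) _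

section Finite

variable [Finite X] [Finite Y] [Finite V] [Finite M]

lemma optError_le (p : Ω → ℝ) (x : Ω → X) (y : Ω → Y) (v : Ω → V) (t : W → U → ℝ)
    (enc : X → W) (helper : V → M) (dec : U → Y → M → X) :
    optError M p x y v t enc ≤ codeError p x y v t enc helper dec := by
  classical
  exact ciInf_le (Set.finite_range _).bddBelow (helper, dec)

lemma exists_codeError_eq_optError [Nonempty X] [Nonempty M] (p : Ω → ℝ) (x : Ω → X) (y : Ω → Y)
    (v : Ω → V) (t : W → U → ℝ) (enc : X → W) :
    ∃ (helper : V → M) (dec : U → Y → M → X),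
      codeError p x y v t enc helper dec = optError M p x y v t enc := by
  classical
  obtain ⟨c, hc⟩ := exists_eq_ciInf_of_finite
    (f := fun c : (V → M) × (U → Y → M → X) => codeError p x y v t enc c.1 c.2)
  exact ⟨c.1, c.2, hc⟩

end Finite

variable [Finite Y] [Finite V] [Fintype M] [Fintype L]

lemma optError_le_of_typicality [Finite X] [Fintype A] [Nonempty X] [Nonempty M] [Nonempty L]
    {p : Ω → ℝ} (hp : p ∈ stdSimplex ℝ Ω) {x : Ω → X} {y : Ω → Y} {v : Ω → V} {a : Ω → A}
    (hM : IsMarkovChain p (fun ω => (x ω, y ω)) v a) {t : W → U → ℝ}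
    (ht : ∀ w, t w ∈ stdSimplex ℝ U) (G₁ : A → Y → Prop) (G₂ : X → A → Y → Prop)
    (G₃ : W → U → Prop) {γ σ : ℝ} (hγ0 : 0 ≤ γ) (hσ : 0 < σ)
    (hγ : γ ≤ σ ^ 2 * Fintype.card (M × L)) (enc : X → W) :
    optError M p x y v t enc
      ≤ expect p (fun ω => ind (¬G₁ (a ω) (y ω)) + ind (¬G₂ (x ω) (a ω) (y ω)) +
          prob (t (enc (x ω))) fun u => ¬G₃ (enc (x ω)) u ∨
            ∃ x', x' ≠ x ω ∧ G₂ x' (a ω) (y ω) ∧ G₃ (enc x') u)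
        + (Fintype.card L - 1) * expect p (fun ω => prob (law p a) fun a' => G₁ a' (y ω))
        + (σ + 2 * prob p fun ω => γ < infoDensity p v a (v ω) (a ω)) := by
  classical
  choose dec hdec using exists_typicality_decoder (Y := Y) (M := M) (L := L) G₁ G₂ G₃ enc
  set err : (M × L → A) → Ω → M → ℝ := fun c ω m =>
    prob (t (enc (x ω))) fun u => dec c u (y ω) m ≠ x ω
  set F : X × Y → A → ℝ := fun s a' => ind (¬G₁ a' s.2) + ind (¬G₂ s.1 a' s.2) +
    prob (t (enc s.1)) fun u => ¬G₃ (enc s.1) u ∨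
      ∃ x', x' ≠ s.1 ∧ G₂ x' a' s.2 ∧ G₃ (enc x') u
  have herr : ∀ c ω m l, err c ω m
      ≤ F (x ω, y ω) (c (m, l)) + ∑ l', ind (l' ≠ l) * ind (G₁ (c (m, l')) (y ω)) := by
    intro c ω m l
    simp only [err, F]
    rw [prob, prob, ← expect_const (ht (enc (x ω))) (ind _ + ind _),
      ← expect_const (ht (enc (x ω))) (∑ l', _), ← expect_add, ← expect_add]
    refine expect_mono (ht _).1 fun u _ => (ind_mono (hdec c u (y ω) (x ω) m l)).trans ?_
    refine (ind_or_le _ _).trans ?_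
    rw [add_assoc]
    refine add_le_add (ind_or_le _ _) ((ind_or_le _ _).trans (add_le_add_right ?_ _))
    exact (ind_exists_le _).trans_eq (sum_congr rfl fun l' _ => ind_and _ _)
  obtain ⟨c, helper, hle⟩ := exists_binning hp hM (err := err) (F := F)
    (G := fun s a' => ind (G₁ a' s.2))
    (fun c ω m => prob_nonneg (ht _).1 _)
    (fun c ω m => (expect_mono (ht _).1 fun u _ => ind_le_one _).trans_eq (expect_const (ht _) 1))
    herr hγ0 hσ hγ
  refine (optError_le p x y v t enc helper (dec c)).trans ?_
  rw [codeError_eq_expect]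
  exact hle

section RandomCode

variable [Fintype X] [Fintype W] [DecidableEq X]

lemma expect_encoder_pair {pW : W → ℝ} (hpW : pW ∈ stdSimplex ℝ W) (t : W → U → ℝ)
    (H : W → U → ℝ) {x x' : X} (hx : x' ≠ x) :
    expect (piPmf fun _ : X => pW) (fun enc => expect (t (enc x)) (H (enc x')))
      = expect pW fun w => expect (law (jointPmf pW t) Prod.snd) (H w) := by
  rw [expect_comm]
  calc expect (piPmf fun _ : X => pW) (fun enc => ∑ u, t (enc x) u * H (enc x') u)
      = ∑ u, expect pW (fun w => t w u) * expect pW (fun w => H w u) := by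
        rw [expect_sum]
        exact sum_congr rfl fun u _ => expect_piPmf_apply_mul_apply (fun _ => hpW) hx.symm
          (fun w => t w u) fun w => H w u
    _ = expect (law (jointPmf pW t) Prod.snd) fun u => expect pW fun w => H w u :=
        sum_congr rfl fun u _ => by rw [law_jointPmf_snd]

lemma expect_encoder_prob_le {pW : W → ℝ} (hpW : pW ∈ stdSimplex ℝ W) {t : W → U → ℝ}
    (ht : ∀ w, t w ∈ stdSimplex ℝ U) (D : X → Prop) (G : W → U → Prop) (x : X) :
    expect (piPmf fun _ : X => pW) (fun enc => prob (t (enc x)) fun u =>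
        ¬G (enc x) u ∨ ∃ x', x' ≠ x ∧ D x' ∧ G (enc x') u)
      ≤ prob (jointPmf pW t) (fun z => ¬G z.1 z.2)
        + (∑ x', ind (D x')) * expect pW fun w => prob (law (jointPmf pW t) Prod.snd) (G w) := by
  have hpX : (piPmf fun _ : X => pW) ∈ stdSimplex ℝ (X → W) := piPmf_mem_stdSimplex fun _ => hpW
  have hunion : ∀ enc : X → W, prob (t (enc x)) (fun u =>
      ¬G (enc x) u ∨ ∃ x', x' ≠ x ∧ D x' ∧ G (enc x') u)
      ≤ prob (t (enc x)) (fun u => ¬G (enc x) u)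
        + ∑ x', ind (x' ≠ x) * ind (D x') * prob (t (enc x)) (G (enc x')) := by
    intro enc
    simp only [prob, ← expect_const_mul, ← expect_sum, ← expect_add]
    refine expect_mono (ht _).1 fun u _ => (ind_or_le _ _).trans (add_le_add_right
      ((ind_exists_le _).trans_eq (sum_congr rfl fun x' _ => ?_)) _)
    rw [ind_and, ind_and, mul_assoc]
  refine (expect_mono hpX.1 fun enc _ => hunion enc).trans ?_
  rw [expect_add, expect_sum, sum_mul]
  refine add_le_add (le_of_eq ?_) (sum_le_sum fun x' _ => ?_)
  · rw [prob, expect_jointPmf]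
    exact expect_piPmf_apply (fun _ => hpW) x fun w => prob (t w) fun u => ¬G w u
  · rw [expect_const_mul]
    by_cases hx : x' = x
    · rw [ind_of_not (not_not.2 hx), zero_mul, zero_mul]
      exact mul_nonneg (ind_nonneg _) (expect_nonneg hpW.1 fun w =>
        prob_nonneg (law_mem_stdSimplex (jointPmf_mem_stdSimplex hpW ht) _).1 _)
    · rw [ind_of hx, one_mul]
      exact (congrArg _ (expect_encoder_pair hpW t (fun w u => ind (G w u)) hx)).le

lemma expect_optError_le [Finite A] [Nonempty X] [Nonempty M] [Nonempty L] {p : Ω → ℝ}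
    (hp : p ∈ stdSimplex ℝ Ω) {x : Ω → X} {y : Ω → Y} {v : Ω → V} {a : Ω → A}
    (hM : IsMarkovChain p (fun ω => (x ω, y ω)) v a) {t : W → U → ℝ}
    (ht : ∀ w, t w ∈ stdSimplex ℝ U) {pW : W → ℝ} (hpW : pW ∈ stdSimplex ℝ W)
    {γ₁ γ₃ γ₄ θ σ : ℝ} (hγ₁ : 0 < γ₁) (hγ₃ : 0 < γ₃) (hγ₄ : 0 ≤ γ₄) (hθ : 0 < θ) (hσ : 0 < σ)
    (hcard : γ₄ ≤ σ ^ 2 * Fintype.card (M × L)) :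
    expect (piPmf fun _ : X => pW) (optError M p x y v t)
      ≤ prob p (fun ω => ¬γ₁ < infoDensity p a y (a ω) (y ω))
        + prob p (fun ω => ¬θ < condLaw p x (fun ω => (a ω, y ω)) (x ω) (a ω, y ω))
        + (prob (jointPmf pW t) (fun z =>
            ¬γ₃ < infoDensity (jointPmf pW t) Prod.fst Prod.snd z.1 z.2) + 1 / θ * (1 / γ₃))
        + (Fintype.card L - 1) * (1 / γ₁)
        + (σ + 2 * prob p fun ω => γ₄ < infoDensity p v a (v ω) (a ω)) := by
  have := Fintype.ofFinite A
  have hpX : (piPmf fun _ : X => pW) ∈ stdSimplex ℝ (X → W) := piPmf_mem_stdSimplex fun _ => hpW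
  have hJ := jointPmf_mem_stdSimplex hpW ht
  set G₁ : A → Y → Prop := fun a' y' => γ₁ < infoDensity p a y a' y'
  set G₂ : X → A → Y → Prop := fun x' a' y' => θ < condLaw p x (fun ω => (a ω, y ω)) x' (a', y')
  set G₃ : W → U → Prop := fun w u => γ₃ < infoDensity (jointPmf pW t) Prod.fst Prod.snd w u
  have hcollide : expect p (fun ω => prob (law p a) fun a' => G₁ a' (y ω)) ≤ 1 / γ₁ := by
    have := expect_prob_lt_infoDensity_le hp y a hγ₁
    simpa only [G₁, infoDensity_swap p y a] using this
  have hspurious : expect pW (fun w => prob (law (jointPmf pW t) Prod.snd) (G₃ w)) ≤ 1 / γ₃ := by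
    have := expect_prob_lt_infoDensity_le hJ Prod.fst Prod.snd hγ₃
    rwa [← expect_law (jointPmf pW t) Prod.fst fun w => prob (law (jointPmf pW t) Prod.snd) (G₃ w),
      law_jointPmf_fst pW ht] at this
  refine (expect_mono hpX.1 fun enc _ =>
    optError_le_of_typicality (L := L) hp hM ht G₁ G₂ G₃ hγ₄ hσ hcard enc).trans ?_
  simp only [expect_add, expect_const hpX]
  rw [expect_comm]
  refine add_le_add_left (add_le_add (add_le_add_right ?_ _)
    (mul_le_mul_of_nonneg_left hcollide (sub_nonneg.2 (Nat.one_le_cast.2 Fintype.card_pos)))) _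
  refine (expect_mono hp.1 fun ω _ => expect_encoder_prob_le hpW ht
    (fun x' => G₂ x' (a ω) (y ω)) G₃ (x ω)).trans ?_
  rw [← expect_const hp (_ + 1 / θ * (1 / γ₃))]
  refine expect_mono hp.1 fun ω _ => add_le_add_right ?_ _
  exact mul_le_mul (sum_ind_lt_condLaw_le hp.1 x _ hθ _) hspurious
    (expect_nonneg hpW.1 fun w => prob_nonneg (law_mem_stdSimplex hJ _).1 _) (by positivity)

end RandomCode

end OneShot

section Block

variable {Ω X Y V A U W : Type*} [Fintype Ω]

lemma infoDensity_iid (n : ℕ) (p : Ω → ℝ) (f : Ω → V) (g : Ω → A) (v : Fin n → V) (a : Fin n → A) :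
    infoDensity (iid n p) (fun s i => f (s i)) (fun s i => g (s i)) v a
      = ∏ i, infoDensity p f g (v i) (a i) := by
  simp only [infoDensity, prod_div_distrib, prod_mul_distrib, law_piPmf_prodMk,
    law_piPmf_map (fun _ => p) fun _ => f, law_piPmf_map (fun _ => p) fun _ => g, piPmf]

lemma condLaw_iid (n : ℕ) (p : Ω → ℝ) (f : Ω → X) (g : Ω → A) (h : Ω → Y) (x : Fin n → X)
    (a : Fin n → A) (y : Fin n → Y) :
    condLaw (iid n p) (fun s i => f (s i)) (fun s => (fun i => g (s i), fun i => h (s i))) x (a, y)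
      = ∏ i, condLaw p f (fun ω => (g ω, h ω)) (x i) (a i, y i) := by
  simp only [condLaw, prod_div_distrib, law_piPmf_prodMk, law_piPmf_prodMk₃]

lemma isMarkovChain_iid (n : ℕ) {p : Ω → ℝ} {x : Ω → X} {y : Ω → Y} {v : Ω → V} {a : Ω → A}
    (h : IsMarkovChain p (fun ω => (x ω, y ω)) v a) :
    IsMarkovChain (iid n p) (fun s => (fun i => x (s i), fun i => y (s i))) (fun s i => v (s i))
      (fun s i => a (s i)) := by
  rintro ⟨x', y'⟩ v' a'
  have h₃ : law (iid n p) (fun s => ((fun i => x (s i), fun i => y (s i)), (fun i => v (s i)),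
      fun i => a (s i))) ((x', y'), v', a')
      = ∏ i, law p (fun ω => ((x ω, y ω), v ω, a ω)) ((x' i, y' i), v' i, a' i) := by
    rw [← law_piPmf_prodMk₃ (fun _ => p) (fun ω => (x ω, y ω)) v a fun i => (x' i, y' i)]
    exact law_congr _ fun s => by simp only [Prod.mk.injEq, funext_iff, forall_and]
  have h₂ : law (iid n p) (fun s => ((fun i => x (s i), fun i => y (s i)), fun i => v (s i)))
      ((x', y'), v') = ∏ i, law p (fun ω => ((x ω, y ω), v ω)) ((x' i, y' i), v' i) := by
    rw [← law_piPmf_prodMk (fun _ => p) (fun ω => (x ω, y ω)) v fun i => (x' i, y' i)]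
    exact law_congr _ fun s => by simp only [Prod.mk.injEq, funext_iff, forall_and]
  rw [h₃, h₂, law_piPmf_prodMk, law_piPmf_map (fun _ => p) fun _ => v, piPmf, ← prod_mul_distrib,
    ← prod_mul_distrib]
  exact prod_congr rfl fun i _ => h _ _ _

lemma law_iid_jointPmf [Fintype W] [Fintype U] (n : ℕ) (p : W → ℝ) (t : W → U → ℝ) :
    law (iid n (jointPmf p t)) (fun s => (fun i => (s i).1, fun i => (s i).2))
      = jointPmf (iid n p) fun w => piPmf fun i => t (w i) := by
  classical
  funext ⟨w, u⟩
  rw [law_piPmf_prodMk (fun _ => jointPmf p t) Prod.fst Prod.snd]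
  simp only [jointPmf, piPmf, ← prod_mul_distrib]
  exact prod_congr rfl fun i _ => by simp [law, sum_filter, jointPmf]

lemma sum_law_prodMk_prodMk [Fintype X] (p : Ω → ℝ) (x : Ω → X) (y : Ω → Y) (v : Ω → V) (y' : Y)
    (v' : V) : ∑ x', law p (fun ω => ((x ω, y ω), v ω)) ((x', y'), v')
      = law p (fun ω => (y ω, v ω)) (y', v') := by
  rw [← law_snd_eq_sum p x]
  exact sum_congr rfl fun x' _ => law_congr p fun ω => by simp only [Prod.mk.injEq, and_assoc]

lemma IsMarkovChain.of_prodMk_left [Finite X] {p : Ω → ℝ} {x : Ω → X} {y : Ω → Y} {v : Ω → V}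
    {a : Ω → A} (h : IsMarkovChain p (fun ω => (x ω, y ω)) v a) : IsMarkovChain p y v a := by
  have := Fintype.ofFinite X
  intro y' v' a'
  rw [← sum_law_prodMk_prodMk p x, ← sum_law_prodMk_prodMk p x, sum_mul, sum_mul]
  exact sum_congr rfl fun x' _ => h _ _ _

variable [Fintype X] [Fintype Y] [Fintype V] [Fintype A]

lemma eventually_prob_not_lt_infoDensity_iid_le {p : Ω → ℝ} (hp : p ∈ stdSimplex ℝ Ω) (f : Ω → V)
    (g : Ω → A) {δ η : ℝ} (hδ : 0 < δ) (hη : 0 < η) :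
    ∀ᶠ n : ℕ in atTop, prob (iid n p) (fun s => ¬(2 : ℝ) ^ (n * (mutualInfo p f g - δ))
      < infoDensity (iid n p) (fun s i => f (s i)) (fun s i => g (s i)) (fun i => f (s i))
        fun i => g (s i)) ≤ η := by
  simp only [infoDensity_iid, not_lt]
  exact eventually_prob_iid_le hp (r := fun ω => infoDensity p f g (f ω) (g ω))
    (fun ω => infoDensity_pos hp.1 f g) (mutualInfo_eq_expect p f g).symm hδ hη

lemma eventually_prob_lt_infoDensity_iid_le {p : Ω → ℝ} (hp : p ∈ stdSimplex ℝ Ω) (f : Ω → V)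
    (g : Ω → A) {δ η : ℝ} (hδ : 0 < δ) (hη : 0 < η) :
    ∀ᶠ n : ℕ in atTop, prob (iid n p) (fun s => (2 : ℝ) ^ (n * (mutualInfo p f g + δ))
      < infoDensity (iid n p) (fun s i => f (s i)) (fun s i => g (s i)) (fun i => f (s i))
        fun i => g (s i)) ≤ η := by
  have hmean : expect p (fun ω => logb 2 (infoDensity p f g (f ω) (g ω))⁻¹)
      = -mutualInfo p f g := by
    simp only [logb_inv, expect_neg, mutualInfo_eq_expect, infoDensity]
  filter_upwards [eventually_prob_iid_le hp (r := fun ω => (infoDensity p f g (f ω) (g ω))⁻¹)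
    (fun ω hω => inv_pos.2 (infoDensity_pos hp.1 f g hω)) hmean hδ hη] with n hn
  refine (prob_mono (piPmf_mem_stdSimplex fun _ => hp).1 fun s _ hs => ?_).trans hn
  rw [infoDensity_iid] at hs
  rw [prod_inv_distrib, ← neg_add', mul_neg, rpow_neg two_pos.le]
  exact inv_anti₀ (by positivity) hs.le

lemma eventually_prob_not_lt_condLaw_iid_le {p : Ω → ℝ} (hp : p ∈ stdSimplex ℝ Ω) (f : Ω → X)
    (g : Ω → A) (h : Ω → Y) {δ η : ℝ} (hδ : 0 < δ) (hη : 0 < η) :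
    ∀ᶠ n : ℕ in atTop, prob (iid n p) (fun s =>
      ¬(2 : ℝ) ^ (n * (-condEntropy p f (fun ω => (g ω, h ω)) - δ))
        < condLaw (iid n p) (fun s i => f (s i)) (fun s => (fun i => g (s i), fun i => h (s i)))
          (fun i => f (s i)) (fun i => g (s i), fun i => h (s i))) ≤ η := by
  simp only [condLaw_iid, not_lt]
  refine eventually_prob_iid_le hp
    (r := fun ω => condLaw p f (fun ω => (g ω, h ω)) (f ω) (g ω, h ω))
    (fun ω => condLaw_pos hp.1 f fun ω => (g ω, h ω)) ?_ hδ hη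
  rw [condEntropy_eq_expect, expect_neg, neg_neg]
  rfl

lemma eventually_prob_not_lt_infoDensity_jointPmf_le [Fintype U] [Fintype W] {p : W → ℝ}
    (hp : p ∈ stdSimplex ℝ W) {t : W → U → ℝ} (ht : ∀ w, t w ∈ stdSimplex ℝ U) {δ η : ℝ}
    (hδ : 0 < δ) (hη : 0 < η) :
    ∀ᶠ n : ℕ in atTop, prob (jointPmf (iid n p) fun w => piPmf fun i => t (w i)) (fun z =>
      ¬(2 : ℝ) ^ (n * (mutualInfo (jointPmf p t) Prod.fst Prod.snd - δ))
        < infoDensity (jointPmf (iid n p) fun w => piPmf fun i => t (w i)) Prod.fst Prod.snd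
          z.1 z.2) ≤ η := by
  classical
  filter_upwards [eventually_prob_not_lt_infoDensity_iid_le (jointPmf_mem_stdSimplex hp ht)
    Prod.fst Prod.snd hδ hη] with n hn
  rw [← law_iid_jointPmf, prob, expect_law]
  simpa only [prob, infoDensity, law_law] using hn

lemma condMutualInfo_eq_mutualInfo_sub {p : Ω → ℝ} (hp : ∀ ω, 0 ≤ p ω) {y : Ω → Y} {v : Ω → V}
    {a : Ω → A} (h : IsMarkovChain p y v a) :
    condMutualInfo p v a y = mutualInfo p v a - mutualInfo p a y := by
  rw [condMutualInfo_eq_expect, mutualInfo_eq_expect, mutualInfo_eq_expect, ← expect_sub]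
  refine expect_congr fun ω hω => ?_
  have hv := law_pos hp v hω
  have ha := law_pos hp a hω
  have hy := law_pos hp y hω
  have hva := law_pos hp (fun ω => (v ω, a ω)) hω
  have hay := law_pos hp (fun ω => (a ω, y ω)) hω
  have hvy := law_pos hp (fun ω => (v ω, y ω)) hω
  have hM : law p (fun ω => (v ω, a ω, y ω)) (v ω, a ω, y ω) * law p v (v ω)
      = law p (fun ω => (v ω, y ω)) (v ω, y ω) * law p (fun ω => (v ω, a ω)) (v ω, a ω) := by
    rw [law_prodMk_swap p v y, ← h (y ω) (v ω) (a ω)]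
    congr 1
    exact law_congr p fun ω' => by simp only [Prod.mk.injEq]; tauto
  rw [← logb_div (by positivity) (by positivity)]
  congr 1
  field_simp
  linear_combination hM

end Block

section Rates

lemma eventually_two_rpow_neg_le {δ η : ℝ} (hδ : 0 < δ) (hη : 0 < η) :
    ∀ᶠ n : ℕ in atTop, (2 : ℝ) ^ (-(n * δ)) ≤ η := by
  have hlim : Tendsto (fun n : ℕ => ((2 : ℝ) ^ (-δ)) ^ n) atTop (nhds 0) :=
    tendsto_pow_atTop_nhds_zero_of_lt_one (by positivity)
      (rpow_lt_one_of_one_lt_of_neg one_lt_two (neg_lt_zero.2 hδ))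
  filter_upwards [hlim.eventually_le_const hη] with n hn
  rwa [← rpow_natCast, ← rpow_mul two_pos.le, neg_mul, mul_comm] at hn

lemma two_rpow_div_two_le_numMessages (n : ℕ) {R : ℝ} (hR : 0 ≤ R) :
    (2 : ℝ) ^ (n * R) / 2 ≤ numMessages n R :=
  (Nat.div_two_lt_floor (one_le_rpow one_le_two (by positivity))).le

lemma numMessages_pos (n : ℕ) {R : ℝ} (hR : 0 ≤ R) : 0 < numMessages n R :=
  Nat.floor_pos.2 (one_le_rpow one_le_two (by positivity))

lemma two_rpow_le_mul_of_rates {n R I J δ M L : ℝ} (hn : 0 ≤ n) (hδ : 0 ≤ δ)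
    (hR : R = I - J + 8 * δ) (hM : 2 ^ (n * R) / 2 ≤ M) (hL : 2 ^ (n * (J - 2 * δ)) ≤ L) :
    (2 : ℝ) ^ (n * (I + δ)) ≤ (2 * 2 ^ (-(n * δ))) ^ 2 * (M * L) := by
  have hsplit : (2 : ℝ) ^ (n * (I + 4 * δ))
      = (2 ^ (-(n * δ))) ^ 2 * (2 ^ (n * R) * 2 ^ (n * (J - 2 * δ))) := by
    rw [sq, ← rpow_add two_pos, ← rpow_add two_pos, ← rpow_add two_pos, hR]
    congr 1
    ring
  calc (2 : ℝ) ^ (n * (I + δ)) ≤ 2 ^ (n * (I + 4 * δ)) := by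
        gcongr
        · exact one_le_two
        · linarith
    _ ≤ 2 * 2 ^ (n * (I + 4 * δ)) := le_mul_of_one_le_left (by positivity) one_le_two
    _ = (2 * 2 ^ (-(n * δ))) ^ 2 * (2 ^ (n * R) / 2 * 2 ^ (n * (J - 2 * δ))) := by
        rw [hsplit]
        ring
    _ ≤ (2 * 2 ^ (-(n * δ))) ^ 2 * (M * L) := by
        have hM0 : 0 ≤ M := (by positivity : (0 : ℝ) ≤ 2 ^ (n * R) / 2).trans hM
        gcongr

lemma one_div_two_rpow_mul (r s : ℝ) :
    1 / (2 : ℝ) ^ r * (1 / 2 ^ s) = 2 ^ (-(r + s)) := by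
  rw [one_div, one_div, ← rpow_neg two_pos.le, ← rpow_neg two_pos.le, ← rpow_add two_pos, neg_add]

lemma natCeil_sub_one_mul_le (r s : ℝ) :
    ((⌈(2 : ℝ) ^ r⌉₊ : ℝ) - 1) * (1 / 2 ^ s) ≤ 2 ^ (-(s - r)) := by
  have hceil := (Nat.ceil_lt_add_one (rpow_nonneg two_pos.le r)).le
  calc ((⌈(2 : ℝ) ^ r⌉₊ : ℝ) - 1) * (1 / 2 ^ s) ≤ 2 ^ r * (1 / 2 ^ s) := by
        gcongr
        linarith
    _ = 2 ^ (-(s - r)) := by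
        rw [one_div, ← rpow_neg two_pos.le, ← rpow_add two_pos, neg_sub, sub_eq_add_neg]

end Rates

section Achievability

variable {Ω X Y V A W U : Type*} [Fintype Ω] [Fintype X] [Fintype Y] [Fintype V] [Fintype A]
  [Fintype W] [Fintype U]

lemma expect_optError_iid_le [DecidableEq X] [Nonempty X] {p : Ω → ℝ} (hp : p ∈ stdSimplex ℝ Ω)
    {x : Ω → X} {y : Ω → Y} {v : Ω → V} {a : Ω → A}
    (hM : IsMarkovChain p (fun ω => (x ω, y ω)) v a) {t : W → U → ℝ}
    (ht : ∀ w, t w ∈ stdSimplex ℝ U) {pW : W → ℝ} (hpW : pW ∈ stdSimplex ℝ W) {n nc : ℕ}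
    {R δ d r : ℝ} (hδ : 0 ≤ δ) (hR : R = condMutualInfo p v a y + 8 * δ)
    (hr : nc * r = n * (condEntropy p x (fun ω => (a ω, y ω)) + 3 * d)) :
    expect (piPmf fun _ : Fin n → X => iid nc pW)
        (optError (Fin (numMessages n R)) (iid n p) (fun s i => x (s i)) (fun s i => y (s i))
          (fun s i => v (s i)) fun w => piPmf fun i => t (w i))
      ≤ prob (iid n p) (fun s => ¬(2 : ℝ) ^ (n * (mutualInfo p a y - δ))
          < infoDensity (iid n p) (fun s i => a (s i)) (fun s i => y (s i)) (fun i => a (s i))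
            fun i => y (s i))
        + prob (iid n p) (fun s =>
          ¬(2 : ℝ) ^ (n * (-condEntropy p x (fun ω => (a ω, y ω)) - d))
            < condLaw (iid n p) (fun s i => x (s i))
              (fun s => (fun i => a (s i), fun i => y (s i)))
              (fun i => x (s i)) (fun i => a (s i), fun i => y (s i)))
        + (prob (jointPmf (iid nc pW) fun w => piPmf fun i => t (w i)) (fun z =>
          ¬(2 : ℝ) ^ (nc * r)
            < infoDensity (jointPmf (iid nc pW) fun w => piPmf fun i => t (w i)) Prod.fst Prod.snd
              z.1 z.2) + 2 ^ (-(n * (2 * d))))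
        + 2 ^ (-(n * δ))
        + (2 * 2 ^ (-(n * δ)) + 2 * prob (iid n p) (fun s =>
          (2 : ℝ) ^ (n * (mutualInfo p v a + δ))
            < infoDensity (iid n p) (fun s i => v (s i)) (fun s i => a (s i)) (fun i => v (s i))
              fun i => a (s i))) := by
  set L := ⌈(2 : ℝ) ^ (n * (mutualInfo p a y - 2 * δ))⌉₊
  have hR0 : 0 ≤ R := by linarith [condMutualInfo_nonneg hp.1 v a y]
  have : Nonempty (Fin (numMessages n R)) := ⟨⟨0, numMessages_pos n hR0⟩⟩
  have : Nonempty (Fin L) := ⟨⟨0, Nat.ceil_pos.2 (by positivity)⟩⟩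
  have hcard : (2 : ℝ) ^ (n * (mutualInfo p v a + δ))
      ≤ (2 * 2 ^ (-(n * δ))) ^ 2 * Fintype.card (Fin (numMessages n R) × Fin L) := by
    rw [Fintype.card_prod, Fintype.card_fin, Fintype.card_fin, Nat.cast_mul]
    refine two_rpow_le_mul_of_rates n.cast_nonneg hδ ?_
      (two_rpow_div_two_le_numMessages n hR0) (Nat.le_ceil _)
    rw [hR, condMutualInfo_eq_mutualInfo_sub hp.1 hM.of_prodMk_left]
  refine (expect_optError_le (M := Fin (numMessages n R)) (L := Fin L)
    (piPmf_mem_stdSimplex fun _ : Fin n => hp) (isMarkovChain_iid n hM)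
    (fun w : Fin nc → W => piPmf_mem_stdSimplex fun i => ht (w i))
    (piPmf_mem_stdSimplex fun _ : Fin nc => hpW)
    (γ₁ := 2 ^ (n * (mutualInfo p a y - δ))) (γ₃ := 2 ^ (nc * r))
    (γ₄ := 2 ^ (n * (mutualInfo p v a + δ)))
    (θ := 2 ^ (n * (-condEntropy p x (fun ω => (a ω, y ω)) - d))) (σ := 2 * 2 ^ (-(n * δ)))
    (by positivity) (by positivity) (by positivity) (by positivity) (by positivity) hcard).trans ?_
  rw [one_div_two_rpow_mul, Fintype.card_fin]
  have hexponent : n * (-condEntropy p x (fun ω => (a ω, y ω)) - d) + nc * r = n * (2 * d) := by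
    linear_combination hr
  rw [hexponent]
  refine add_le_add_left (add_le_add_right ((natCeil_sub_one_mul_le _ _).trans_eq ?_) _) _
  congr 1
  ring

lemma exists_forall_codeError_le {ι : Type*} [Fintype ι] {X W : Type*} [Fintype X] [Fintype W]
    [DecidableEq X] [Nonempty X] {Y V U M : ι → Type*} [∀ k, Finite (Y k)] [∀ k, Finite (V k)]
    [∀ k, Fintype (U k)] [∀ k, Finite (M k)] [∀ k, Nonempty (M k)] {p : Ω → ℝ}
    (hp : ∀ ω, 0 ≤ p ω) (x : Ω → X) (y : ∀ k, Ω → Y k) (v : ∀ k, Ω → V k)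
    {t : ∀ k, W → U k → ℝ} (ht : ∀ k w u, 0 ≤ t k w u) {pE : (X → W) → ℝ}
    (hpE : pE ∈ stdSimplex ℝ (X → W)) {ε : ℝ}
    (h : ∑ k, expect pE (optError (M k) p x (y k) (v k) (t k)) ≤ ε) :
    ∃ (enc : X → W) (helper : ∀ k, V k → M k) (dec : ∀ k, U k → Y k → M k → X),
      ∀ k, codeError p x (y k) (v k) (t k) enc (helper k) (dec k) ≤ ε := by
  rw [← expect_sum] at h
  obtain ⟨enc, henc⟩ := exists_le_of_expect_le hpE h
  choose helper dec hcode using fun k =>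
    exists_codeError_eq_optError (M := M k) p x (y k) (v k) (t k) enc
  refine ⟨enc, helper, dec, fun k => (hcode k).trans_le (le_trans ?_ henc)⟩
  exact single_le_sum (f := fun k => optError (M k) p x (y k) (v k) (t k) enc)
    (fun k _ => optError_nonneg hp _ _ _ (ht k) enc) (mem_univ k)

lemma eventually_expect_optError_le [DecidableEq X] [Nonempty X] {p : Ω → ℝ}
    (hp : p ∈ stdSimplex ℝ Ω) {x : Ω → X} {y : Ω → Y} {v : Ω → V} {a : Ω → A}
    (hM : IsMarkovChain p (fun ω => (x ω, y ω)) v a) {t : W → U → ℝ}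
    (ht : ∀ w, t w ∈ stdSimplex ℝ U) {pW : W → ℝ} (hpW : pW ∈ stdSimplex ℝ W) {κ R ε : ℝ}
    (hκ0 : 0 < κ) (hR : condMutualInfo p v a y < R)
    (hκ : condEntropy p x (fun ω => (a ω, y ω)) < κ * mutualInfo (jointPmf pW t) Prod.fst Prod.snd)
    (hε : 0 < ε) :
    ∀ᶠ n : ℕ × ℕ in atTop ×ˢ atTop, (n.2 : ℝ) = κ * n.1 →
      expect (piPmf fun _ : Fin n.1 → X => iid n.2 pW)
        (optError (Fin (numMessages n.1 R)) (iid n.1 p) (fun s i => x (s i)) (fun s i => y (s i))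
          (fun s i => v (s i)) fun w => piPmf fun i => t (w i)) ≤ ε := by
  set δ := (R - condMutualInfo p v a y) / 8 with hδ_def
  set d := (κ * mutualInfo (jointPmf pW t) Prod.fst Prod.snd
    - condEntropy p x fun ω => (a ω, y ω)) / 4 with hd_def
  have hδ : 0 < δ := by linarith
  have hd : 0 < d := by linarith
  have hη : 0 < ε / 9 := by positivity
  filter_upwards [
    ((eventually_prob_not_lt_infoDensity_iid_le hp a y hδ hη).and
    ((eventually_prob_lt_infoDensity_iid_le hp v a hδ hη).and
    ((eventually_prob_not_lt_condLaw_iid_le hp x a y hd hη).and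
    ((eventually_two_rpow_neg_le hδ hη).and
      (eventually_two_rpow_neg_le (mul_pos two_pos hd) hη))))).prod_inl atTop,
    (eventually_prob_not_lt_infoDensity_jointPmf_le hpW ht (div_pos hd hκ0) hη).prod_inr atTop]
    with ⟨n, nc⟩ ⟨h₁, h₂, h₃, h₄, h₅⟩ h₆ hnc
  have hr : nc * (mutualInfo (jointPmf pW t) Prod.fst Prod.snd - d / κ)
      = n * (condEntropy p x (fun ω => (a ω, y ω)) + 3 * d) := by
    have hκd : κ * (d / κ) = d := mul_div_cancel₀ d hκ0.ne'
    linear_combination (mutualInfo (jointPmf pW t) Prod.fst Prod.snd - d / κ) * hnc - n * hκd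
      - (4 * n : ℝ) * hd_def
  have hbound := expect_optError_iid_le hp hM ht hpW hδ.le (by linarith : R = _ + 8 * δ) hr
  dsimp only at h₁ h₂ h₃ h₄ h₅ h₆ hbound ⊢
  linarith

end Achievability

section Receivers

variable {K : ℕ} {X W : Type*} {Y V U : Fin K → Type*} [∀ k, Fintype (U k)]

/-- The channel from the input of the broadcast channel `T` to receiver `k`. -/
def receiverChannel (T : W → (∀ k, U k) → ℝ) (k : Fin K) (w : W) : U k → ℝ :=
  law (T w) fun u => u k

lemma receiverChannel_mem_stdSimplex {T : W → (∀ k, U k) → ℝ}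
    (hT : ∀ w, T w ∈ stdSimplex ℝ (∀ k, U k)) (k : Fin K) (w : W) :
    receiverChannel T k w ∈ stdSimplex ℝ (U k) :=
  law_mem_stdSimplex (hT w) _

lemma channelInfo_eq [Fintype W] (PW : W → ℝ) (T : W → (∀ k, U k) → ℝ) (k : Fin K) :
    channelInfo PW T k = mutualInfo (jointPmf PW (receiverChannel T k)) Prod.fst Prod.snd := by
  rw [show receiverChannel T k = fun w => law (T w) fun u => u k from rfl,
    ← law_jointPmf_map_snd, ← mutualInfo_comp]
  rfl

variable [Fintype X] [∀ k, Fintype (Y k)] [∀ k, Fintype (V k)]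

lemma Code.errorProb_eq_codeError {ns nc : ℕ} {R : Fin K → ℝ} (c : Code X W Y V U ns nc R)
    (P : Letter X Y V → ℝ) (T : W → (∀ k, U k) → ℝ) (k : Fin K) :
    c.errorProb P T k = codeError (iid ns P) (fun s i => (s i).1) (fun s i => (s i).2.1 k)
      (fun s i => (s i).2.2 k) (fun w => piPmf fun i => receiverChannel T k (w i))
      c.enc (c.helper k) (c.dec k) := by
  have hchannel : ∀ w : Fin nc → W, (piPmf fun i => receiverChannel T k (w i))
      = law (piPmf fun i => T (w i)) fun u i => u i k := fun w =>
    (law_piPmf_map (fun i => T (w i)) fun _ u => u k).symm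
  rw [codeError_eq_expect]
  simp only [hchannel, prob, expect_law]
  simp only [expect, mul_sum]
  refine sum_congr rfl fun s _ => sum_congr rfl fun u _ => ?_
  rw [ind, mul_ite, mul_ite, mul_one, mul_zero, mul_zero]
  congr

variable {P : Letter X Y V → ℝ} {T : W → (∀ k, U k) → ℝ}

lemma eventually_exists_code [Fintype W] (hT : ∀ w, T w ∈ stdSimplex ℝ (∀ k, U k)) {κ : ℝ}
    (hκ : 0 < κ) {R : Fin K → ℝ} {PW : W → ℝ} (hPW : PW ∈ stdSimplex ℝ W) {m : Fin K → ℕ}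
    {Q : Letter X Y V × (∀ k, Fin (m k)) → ℝ} (hQ : IsAuxiliary P m Q)
    (h : ∀ k, helperInfo m Q k < R k ∧ equivocation m Q k < κ * channelInfo PW T k) {ε : ℝ}
    (hε : 0 < ε) :
    ∀ᶠ n : ℕ × ℕ in atTop ×ˢ atTop, (n.2 : ℝ) = κ * n.1 →
      ∃ c : Code X W Y V U n.1 n.2 R, ∀ k, c.errorProb P T k ≤ ε := by
  classical
  obtain ⟨hQ, rfl, hM⟩ := hQ
  have hX : Nonempty X := (nonempty_of_mem_stdSimplex hQ).map fun z => z.1.1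
  have hR : ∀ k, 0 ≤ R k := fun k => (condMutualInfo_nonneg hQ.1 _ _ _).trans (h k).1.le
  have hlim : ∀ k, ∀ᶠ n : ℕ × ℕ in atTop ×ˢ atTop, (n.2 : ℝ) = κ * n.1 →
      expect (piPmf fun _ => iid n.2 PW) (optError (Fin (numMessages n.1 (R k))) (iid n.1 Q)
        (fun s i => (s i).1.1) (fun s i => (s i).1.2.1 k) (fun s i => (s i).1.2.2 k)
        fun w => piPmf fun i => receiverChannel T k (w i)) ≤ ε / (K + 1) := fun k =>
    eventually_expect_optError_le hQ (hM k) (receiverChannel_mem_stdSimplex hT k) hPW hκ (h k).1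
      (channelInfo_eq PW T k ▸ (h k).2) (by positivity)
  filter_upwards [eventually_all.2 hlim] with n hn hratio
  have hMsg : ∀ k, Nonempty (Fin (numMessages n.1 (R k))) := fun k =>
    ⟨⟨0, numMessages_pos n.1 (hR k)⟩⟩
  obtain ⟨enc, helper, dec, hcode⟩ := exists_forall_codeError_le
    (M := fun k => Fin (numMessages n.1 (R k))) (piPmf_mem_stdSimplex fun _ : Fin n.1 => hQ).1
    (fun s i => (s i).1.1) (fun k s i => (s i).1.2.1 k) (fun k s i => (s i).1.2.2 k)
    (fun k w => (piPmf_mem_stdSimplex fun i => receiverChannel_mem_stdSimplex hT k (w i)).1)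
    (piPmf_mem_stdSimplex fun _ => piPmf_mem_stdSimplex fun _ : Fin n.2 => hPW) (ε := ε) (by
      refine (sum_le_card_nsmul univ _ (ε / (K + 1)) fun k _ => hn k hratio).trans ?_
      rw [card_univ, Fintype.card_fin, nsmul_eq_mul, mul_div_assoc', div_le_iff₀ (by positivity)]
      linarith)
  have hsource : iid n.1 (law Q Prod.fst) = law (iid n.1 Q) fun s i => (s i).1 :=
    (law_piPmf_map (fun _ => Q) fun _ => Prod.fst).symm
  refine ⟨⟨enc, helper, dec⟩, fun k => le_trans (le_of_eq ?_) (hcode k)⟩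
  rw [Code.errorProb_eq_codeError, codeError_eq_expect, codeError_eq_expect, hsource]
  exact expect_law _ _ _

theorem achievable_of_isAuxiliary [Fintype W] (hT : ∀ w, T w ∈ stdSimplex ℝ (∀ k, U k))
    {κ : ℚ} (hκ : 0 < κ) {R : Fin K → ℝ} {PW : W → ℝ} (hPW : PW ∈ stdSimplex ℝ W) {m : Fin K → ℕ}
    {Q : Letter X Y V × (∀ k, Fin (m k)) → ℝ} (hQ : IsAuxiliary P m Q)
    (h : ∀ k, helperInfo m Q k < R k ∧ equivocation m Q k < κ * channelInfo PW T k) :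
    Achievable P T κ R := by
  intro ε hε
  obtain ⟨N, hN⟩ := eventually_atTop_prod_self'.1 (prod_atTop_atTop_eq (α := ℕ) (β := ℕ) ▸
    eventually_exists_code hT (Rat.cast_pos.2 hκ) hPW hQ h hε)
  refine ⟨N, fun ns nc hns hnc hratio => hN ns hns nc hnc ?_⟩
  have hns0 : (ns : ℚ) ≠ 0 := fun h0 => hκ.ne (by rwa [h0, div_zero] at hratio)
  exact_mod_cast (div_eq_iff hns0).1 hratio

lemma achievableInfinitelyOften_of_achievable {κ : ℚ} (hκ : 0 < κ) {R : Fin K → ℝ}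
    (h : Achievable P T κ R) : AchievableInfinitelyOften P T κ R := by
  intro ε hε N
  obtain ⟨N₀, hN₀⟩ := h ε hε
  set l := N + N₀ + 1
  have hnum : 0 < κ.num.toNat := Int.lt_toNat.2 (Rat.num_pos.2 hκ)
  have hratio : ((κ.num.toNat * l : ℕ) : ℚ) / (κ.den * l : ℕ) = κ := by
    have hcast : ((κ.num.toNat : ℕ) : ℚ) = κ.num := by
      exact_mod_cast Int.toNat_of_nonneg (Rat.num_pos.2 hκ).le
    push_cast
    rw [hcast, mul_div_mul_right _ _ (by positivity), Rat.num_div_den]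
  have hden : l ≤ κ.den * l := Nat.le_mul_of_pos_left l κ.den_pos
  have hnum : l ≤ κ.num.toNat * l := Nat.le_mul_of_pos_left l hnum
  exact ⟨κ.den * l, κ.num.toNat * l, by omega, by omega, hratio,
    hN₀ _ _ (by omega) (by omega) hratio⟩

end Receivers

section ChannelConverse

variable {S F Z ι W U : Type*} [Fintype S] [Fintype F] [Fintype Z] [Fintype ι] [Fintype W]
  [Fintype U]

lemma mutualInfo_jointPmf (p : W → ℝ) {t : W → U → ℝ}
    (ht : ∀ w, t w ∈ stdSimplex ℝ U) :
    mutualInfo (jointPmf p t) Prod.fst Prod.snd = expect (jointPmf p t) fun z =>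
      logb 2 (t z.1 z.2 / law (jointPmf p t) Prod.snd z.2) := by
  rw [mutualInfo_eq_expect]
  refine expect_congr fun z hz => ?_
  rw [law_jointPmf_fst p ht, show law (jointPmf p t) (fun z => (z.1, z.2)) (z.1, z.2)
    = p z.1 * t z.1 z.2 from congrFun (law_id _) z,
    mul_div_mul_left _ _ (left_ne_zero_of_mul hz)]

lemma condEntropy_jointPmf_snd_fst (p : S → ℝ) {t : S → U → ℝ} (ht : ∀ s, t s ∈ stdSimplex ℝ U) :
    condEntropy (jointPmf p t) Prod.snd Prod.fst
      = expect (jointPmf p t) fun z => -logb 2 (t z.1 z.2) := by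
  rw [condEntropy_eq_expect]
  refine expect_congr fun z hz => ?_
  rw [law_jointPmf_fst p ht, law_prodMk_swap, show law (jointPmf p t) (fun z => (z.1, z.2))
    (z.1, z.2) = p z.1 * t z.1 z.2 from congrFun (law_id _) z,
    mul_div_cancel_left₀ _ (left_ne_zero_of_mul hz)]

/-- The law of a uniformly chosen letter of the random codeword `w`. -/
def averageInput (p : S → ℝ) (w : S → ι → W) : W → ℝ :=
  law (jointPmf p fun _ (_ : ι) => (Fintype.card ι : ℝ)⁻¹) fun z => w z.1 z.2

lemma averageInput_mem_stdSimplex [Nonempty ι] {p : S → ℝ} (hp : p ∈ stdSimplex ℝ S)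
    (w : S → ι → W) : averageInput p w ∈ stdSimplex ℝ W :=
  law_mem_stdSimplex (jointPmf_mem_stdSimplex hp fun _ => ⟨fun _ => by positivity, by simp⟩) _

lemma expect_jointPmf_averageInput [DecidableEq ι] [Nonempty ι] (p : S → ℝ) (w : S → ι → W)
    {t : W → U → ℝ} (ht : ∀ w, t w ∈ stdSimplex ℝ U) (G : W → U → ℝ) :
    expect (jointPmf p fun s => piPmf fun i => t (w s i)) (fun z => ∑ i, G (w z.1 i) (z.2 i))
      = Fintype.card ι * expect (jointPmf (averageInput p w) t) fun z => G z.1 z.2 := by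
  rw [expect_jointPmf, expect_jointPmf, averageInput, expect_law, expect_jointPmf,
    ← expect_const_mul]
  refine expect_congr fun s _ => ?_
  rw [expect_sum, expect, mul_sum]
  refine sum_congr rfl fun i _ => ?_
  rw [mul_inv_cancel_left₀ (by positivity),
    expect_piPmf_apply (fun i => ht (w s i)) i fun u => G (w s i) u]

lemma law_averageInput_pos [Nonempty ι] {p : S → ℝ} (hp : ∀ s, 0 ≤ p s) (w : S → ι → W)
    {t : W → U → ℝ} (ht : ∀ w u, 0 ≤ t w u) {s : S} {u : ι → U}
    (h : jointPmf p (fun s => piPmf fun i => t (w s i)) (s, u) ≠ 0) (i : ι) :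
    0 < law (jointPmf (averageInput p w) t) Prod.snd (u i) := by
  have huniform : 0 < (Fintype.card ι : ℝ)⁻¹ := by positivity
  have hinput : 0 < averageInput p w (w s i) :=
    law_pos (p := jointPmf p fun _ (_ : ι) => (Fintype.card ι : ℝ)⁻¹)
      (fun z => mul_nonneg (hp z.1) huniform.le) (fun z => w z.1 z.2) (ω := (s, i))
      (mul_ne_zero (left_ne_zero_of_mul h) huniform.ne')
  exact law_pos (fun z => mul_nonneg
    (law_nonneg (fun z : S × ι => mul_nonneg (hp z.1) huniform.le) _ _) (ht _ _)) Prod.snd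
    (ω := (w s i, u i))
    (mul_ne_zero hinput.ne' (ne_zero_of_piPmf_ne_zero (right_ne_zero_of_mul h) i))

lemma condEntropy_sub_condEntropy_le_card_mul_mutualInfo [DecidableEq ι] [Nonempty ι]
    {p : S → ℝ} (hp : p ∈ stdSimplex ℝ S) (w : S → ι → W) {t : W → U → ℝ}
    (ht : ∀ w, t w ∈ stdSimplex ℝ U) (z : S → Z) :
    let J := jointPmf p fun s => piPmf fun i => t (w s i)
    condEntropy J Prod.snd (fun x => z x.1) - condEntropy J Prod.snd Prod.fst
      ≤ Fintype.card ι * mutualInfo (jointPmf (averageInput p w) t) Prod.fst Prod.snd := by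
  intro J
  have hτ : ∀ s, piPmf (fun i => t (w s i)) ∈ stdSimplex ℝ (ι → U) := fun s =>
    piPmf_mem_stdSimplex fun i => ht _
  have hJ : J ∈ stdSimplex ℝ (S × (ι → U)) := jointPmf_mem_stdSimplex hp hτ
  have hI := averageInput_mem_stdSimplex hp w
  set out : U → ℝ := law (jointPmf (averageInput p w) t) Prod.snd
  have hout : out ∈ stdSimplex ℝ U := law_mem_stdSimplex (jointPmf_mem_stdSimplex hI ht) _
  have hpos : ∀ x, J x ≠ 0 → ∀ i, 0 < out (x.2 i) := fun x hx =>
    law_averageInput_pos hp.1 w (fun w => (ht w).1) hx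
  have hupper := condEntropy_le_expect hJ.1 Prod.snd (fun x => z x.1)
    (r := fun _ => piPmf fun _ : ι => out) (fun _ => (piPmf_mem_stdSimplex fun _ => hout).1)
    (fun _ => (piPmf_mem_stdSimplex fun _ => hout).2.le)
    fun x hx => prod_pos fun i _ => hpos x hx i
  rw [condEntropy_jointPmf_snd_fst p hτ, mutualInfo_jointPmf _ ht,
    ← expect_jointPmf_averageInput p w ht fun a u => logb 2 (t a u / out u)]
  refine (sub_le_sub_right hupper _).trans_eq ?_
  rw [← expect_sub]
  refine expect_congr fun x hx => ?_
  have ht0 : ∀ i, t (w x.1 i) (x.2 i) ≠ 0 := ne_zero_of_piPmf_ne_zero (right_ne_zero_of_mul hx)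
  simp only [piPmf]
  rw [logb_prod _ _ fun i _ => ht0 i, logb_prod _ _ fun i _ => (hpos x hx i).ne', neg_sub_neg,
    ← sum_sub_distrib]
  exact sum_congr rfl fun i _ => (logb_div (ht0 i) (hpos x hx i).ne').symm

lemma condEntropy_le_condEntropy_add_card_mul_mutualInfo [DecidableEq ι] [Nonempty ι]
    {p : S → ℝ} (hp : p ∈ stdSimplex ℝ S) (w : S → ι → W) {t : W → U → ℝ}
    (ht : ∀ w, t w ∈ stdSimplex ℝ U) (f : S → F) (z : S → Z) :
    condEntropy p f z
      ≤ condEntropy (jointPmf p fun s => piPmf fun i => t (w s i)) (fun x => f x.1)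
          (fun x => (x.2, z x.1))
        + Fintype.card ι * mutualInfo (jointPmf (averageInput p w) t) Prod.fst Prod.snd := by
  set J := jointPmf p fun s => piPmf fun i => t (w s i)
  have hτ : ∀ s, piPmf (fun i => t (w s i)) ∈ stdSimplex ℝ (ι → U) := fun s =>
    piPmf_mem_stdSimplex fun i => ht _
  have hJ : J ∈ stdSimplex ℝ (S × (ι → U)) := jointPmf_mem_stdSimplex hp hτ
  have hsource : condEntropy p f z = condEntropy J (fun x => f x.1) fun x => z x.1 := by
    rw [condEntropy_comp J Prod.fst, law_jointPmf_fst p hτ]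
  have hchain : condEntropy J (fun x => f x.1) (fun x => z x.1)
        + condEntropy J Prod.snd (fun x => (f x.1, z x.1))
      = condEntropy J Prod.snd (fun x => z x.1)
        + condEntropy J (fun x => f x.1) (fun x => (x.2, z x.1)) := by
    rw [← condEntropy_prodMk hJ.1, ← condEntropy_prodMk hJ.1]
    exact condEntropy_congr J (fun _ _ => Iff.rfl) fun _ _ _ => by
      simp only [Prod.mk.injEq, and_comm]
  have hnoise : condEntropy J Prod.snd Prod.fst ≤ condEntropy J Prod.snd fun x => (f x.1, z x.1) :=
    condEntropy_le_of_factorsThrough hJ.1 _ fun x y h => by rw [h]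
  linarith [condEntropy_sub_condEntropy_le_card_mul_mutualInfo hp w ht z]

end ChannelConverse

section SourceConverse

variable {Ω X Y V M α β : Type*} [Fintype Ω] [Fintype α] [Fintype β]

lemma condEntropy_iid (n : ℕ) {p : Ω → ℝ} (hp : p ∈ stdSimplex ℝ Ω) (f : Ω → α) (g : Ω → β) :
    condEntropy (iid n p) (fun s i => f (s i)) (fun s i => g (s i)) = n * condEntropy p f g := by
  classical
  set r : Ω → ℝ := fun ω => law p (fun ω => (f ω, g ω)) (f ω, g ω) / law p g (g ω)
  have hr : ∀ ω, p ω ≠ 0 → r ω ≠ 0 := fun ω hω =>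
    (div_pos (law_pos hp.1 (fun ω => (f ω, g ω)) hω) (law_pos hp.1 g hω)).ne'
  calc condEntropy (iid n p) (fun s i => f (s i)) (fun s i => g (s i))
      = expect (iid n p) fun s => ∑ i, -logb 2 (r (s i)) := by
        rw [condEntropy_eq_expect]
        refine expect_congr fun s hs => ?_
        rw [law_piPmf_prodMk, law_piPmf_map (fun _ => p) fun _ => g, piPmf, ← prod_div_distrib,
          logb_prod _ _ fun i _ => hr _ (ne_zero_of_piPmf_ne_zero hs i), sum_neg_distrib]
    _ = n * condEntropy p f g := by
        simp only [expect_sum, expect_piPmf_apply (fun _ => hp) _ fun ω => -logb 2 (r ω), sum_const,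
          card_univ, Fintype.card_fin, nsmul_eq_mul, condEntropy_eq_expect, r]

variable {n : ℕ} (p : Ω → ℝ) (y : Ω → Y) (v : Ω → V) (φ : (Fin n → V) → M)

/-- The auxiliary variable `(φ (V₁, …, Vₙ), S₁, …, Sᵢ₋₁, Yᵢ₊₁, …, Yₙ)` that describes the message
`φ` to the `i`-th source letter `Sᵢ`. -/
def auxLetter (i : Fin n) (s : Fin n → Ω) : M × ({j // j < i} → Ω) × ({j // i < j} → Y) :=
  (φ fun j => v (s j), fun j => s j, fun j => y (s j))

/-- The conditional law of `auxLetter y v φ i` when the helper observes the letter `b` at time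
`i`. -/
def auxKernel (i : Fin n) (b : V) : M × ({j // j < i} → Ω) × ({j // i < j} → Y) → ℝ :=
  law (iid n p) fun s =>
    (φ (Function.update (fun j => v (s j)) i b), fun j => s j, fun j => y (s j))

variable {p}

lemma law_auxLetter (hp : p ∈ stdSimplex ℝ Ω) (i : Fin n) :
    law (iid n p) (fun s => (s i, auxLetter y v φ i s))
      = jointPmf p fun ω => auxKernel p y v φ i (v ω) := by
  refine law_piPmf_apply_prodMk (fun _ => hp) i fun s ω => ?_
  have hpast : ∀ j : {j // j < i}, Function.update s i ω j = s j := fun j =>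
    Function.update_of_ne j.2.ne _ _
  have hfuture : ∀ j : {j // i < j}, Function.update s i ω j = s j := fun j =>
    Function.update_of_ne j.2.ne' _ _
  simp only [auxLetter, hpast, hfuture, Function.apply_update (fun _ => v) s i ω]

variable [Fintype X] [Fintype Y] [Fintype M]

lemma auxKernel_mem_stdSimplex (hp : p ∈ stdSimplex ℝ Ω) (i : Fin n) (b : V) :
    auxKernel p y v φ i b ∈ stdSimplex ℝ (M × ({j // j < i} → Ω) × ({j // i < j} → Y)) :=
  law_mem_stdSimplex (piPmf_mem_stdSimplex fun _ => hp) _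

lemma condEntropy_auxLetter (hp : p ∈ stdSimplex ℝ Ω) (x : Ω → X) (i : Fin n) :
    condEntropy (iid n p) (fun s => x (s i)) (fun s => (auxLetter y v φ i s, y (s i)))
      = condEntropy (jointPmf p fun ω => auxKernel p y v φ i (v ω)) (fun z => x z.1)
          fun z => (z.2, y z.1) := by
  rw [← law_auxLetter y v φ hp i]
  exact condEntropy_comp (iid n p) (fun s => (s i, auxLetter y v φ i s)) (fun z => x z.1)
    fun z => (z.2, y z.1)

lemma sum_condEntropy_auxKernel_le (hp : p ∈ stdSimplex ℝ Ω) (x : Ω → X) :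
    ∑ i, condEntropy (jointPmf p fun ω => auxKernel p y v φ i (v ω)) (fun z => x z.1)
        (fun z => (z.2, y z.1))
      ≤ condEntropy (iid n p) (fun s i => x (s i))
          fun s => (φ fun i => v (s i), fun i => y (s i)) := by
  have hiid : ∀ s, 0 ≤ iid n p s := (piPmf_mem_stdSimplex fun _ => hp).1
  rw [condEntropy_pi hiid fun i s => x (s i)]
  refine sum_le_sum fun i _ => ?_
  rw [← condEntropy_auxLetter y v φ hp]
  refine condEntropy_le_of_factorsThrough hiid _ fun s s' h => ?_
  simp only [auxLetter, Prod.mk.injEq, funext_iff, Subtype.forall] at h ⊢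
  obtain ⟨⟨hφ, hpast, hfuture⟩, hi⟩ := h
  refine ⟨fun j hj => by rw [hpast j hj], hφ, fun j => ?_⟩
  rcases lt_trichotomy j i with hj | rfl | hj
  exacts [by rw [hpast j hj], hi, hfuture j hj]

lemma sum_condEntropy_id_auxKernel (hp : p ∈ stdSimplex ℝ Ω) :
    ∑ i, condEntropy (jointPmf p fun ω => auxKernel p y v φ i (v ω)) Prod.fst
        (fun z => (z.2, y z.1))
      = condEntropy (iid n p) (fun s i => s i)
          fun s => (φ fun i => v (s i), fun i => y (s i)) := by
  rw [condEntropy_pi (piPmf_mem_stdSimplex fun _ => hp).1 fun i s => s i]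
  refine sum_congr rfl fun i _ => (condEntropy_auxLetter y v φ hp id i).symm.trans ?_
  refine condEntropy_congr _ (fun s s' => ?_) fun _ _ _ => Iff.rfl
  simp only [auxLetter, Prod.mk.injEq, funext_iff, Subtype.forall]
  refine ⟨fun ⟨⟨hφ, hpast, hfuture⟩, hi⟩ => ⟨hpast, hφ, fun j => ?_⟩,
    fun ⟨hpast, hφ, hy⟩ => ⟨⟨hφ, hpast, fun j _ => hy j⟩, hy i⟩⟩
  rcases lt_trichotomy j i with hj | rfl | hj
  exacts [by rw [hpast j hj], hi, hfuture j hj]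

lemma mul_condEntropy_sub_logb_card_le (hp : p ∈ stdSimplex ℝ Ω) :
    n * condEntropy p id y - logb 2 (Fintype.card M)
      ≤ ∑ i, condEntropy (jointPmf p fun ω => auxKernel p y v φ i (v ω)) Prod.fst
          (fun z => (z.2, y z.1)) := by
  rw [sum_condEntropy_id_auxKernel y v φ hp, ← condEntropy_iid n hp id y, sub_le_iff_le_add]
  exact condEntropy_le_condEntropy_prodMk_add_logb_card (piPmf_mem_stdSimplex fun _ => hp) _ _ _

end SourceConverse

section Continuity

variable {Ω U α β : Type*} [Fintype Ω] [Fintype U] [Fintype α] [Fintype β]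

/-- The entropy of the random variable `f` under `p`, in bits. -/
def entropy (p : Ω → ℝ) (f : Ω → α) : ℝ := expect p fun ω => -logb 2 (law p f (f ω))

lemma entropy_eq_sum_negMulLog (p : Ω → ℝ) (f : Ω → α) :
    entropy p f = ∑ a, negMulLog (law p f a) / log 2 := by
  rw [entropy, ← expect_law p f fun a => -logb 2 (law p f a)]
  exact sum_congr rfl fun a _ => by simp only [logb, negMulLog]; ring

lemma continuous_entropy {α : Type*} [Finite α] (f : Ω → α) :
    Continuous fun p : Ω → ℝ => entropy p f := by
  have := Fintype.ofFinite α
  simp only [entropy_eq_sum_negMulLog, law]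
  exact continuous_finsetSum _ fun a _ => (continuous_negMulLog.comp
    (continuous_finsetSum _ fun ω _ => continuous_apply ω)).div_const _

lemma condEntropy_eq_entropy_sub {p : Ω → ℝ} (hp : ∀ ω, 0 ≤ p ω) (f : Ω → α) (g : Ω → β) :
    condEntropy p f g = entropy p (fun ω => (f ω, g ω)) - entropy p g := by
  rw [condEntropy_eq_expect, entropy, entropy, ← expect_sub]
  refine expect_congr fun ω hω => ?_
  rw [logb_div (law_pos hp (fun ω => (f ω, g ω)) hω).ne' (law_pos hp g hω).ne']
  ring

lemma mutualInfo_eq_entropy_add_sub {p : Ω → ℝ} (hp : ∀ ω, 0 ≤ p ω) (f : Ω → α) (g : Ω → β) :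
    mutualInfo p f g = entropy p f + entropy p g - entropy p (fun ω => (f ω, g ω)) := by
  rw [mutualInfo_eq_expect, entropy, entropy, entropy, ← expect_add, ← expect_sub]
  refine expect_congr fun ω hω => ?_
  have hf := (law_pos hp f hω).ne'
  have hg := (law_pos hp g hω).ne'
  rw [logb_div (law_pos hp (fun ω => (f ω, g ω)) hω).ne' (mul_ne_zero hf hg), logb_mul hf hg]
  ring

lemma continuousOn_condEntropy (f : Ω → α) (g : Ω → β) :
    ContinuousOn (fun p : Ω → ℝ => condEntropy p f g) {p | ∀ ω, 0 ≤ p ω} :=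
  ((continuous_entropy fun ω => (f ω, g ω)).sub (continuous_entropy g)).continuousOn.congr
    fun _ hp => condEntropy_eq_entropy_sub hp f g

lemma continuousOn_mutualInfo (f : Ω → α) (g : Ω → β) :
    ContinuousOn (fun p : Ω → ℝ => mutualInfo p f g) {p | ∀ ω, 0 ≤ p ω} :=
  (((continuous_entropy f).add (continuous_entropy g)).sub
    (continuous_entropy fun ω => (f ω, g ω))).continuousOn.congr
    fun _ hp => mutualInfo_eq_entropy_add_sub hp f g

lemma condEntropy_smul (c : ℝ) (p : Ω → ℝ) (f : Ω → α) (g : Ω → β) :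
    condEntropy (c • p) f g = c * condEntropy p f g := by
  rcases eq_or_ne c 0 with rfl | hc
  · simp [condEntropy_eq_expect, expect]
  · simp only [condEntropy, law, Pi.smul_apply, smul_eq_mul, ← mul_sum, mul_neg,
      mul_div_mul_left _ _ hc, mul_assoc]

lemma condEntropy_jointPmf (p : Ω → ℝ) (q : Ω → U → ℝ) (f : Ω → α) (g : Ω → β) :
    condEntropy (jointPmf p q) (fun z => f z.1) (fun z => (z.2, g z.1))
      = ∑ u, condEntropy (fun ω => p ω * q ω u) f g := by
  classical
  have hg : ∀ u b, law (jointPmf p q) (fun z => (z.2, g z.1)) (u, b)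
      = law (fun ω => p ω * q ω u) g b := by
    intro u b
    simp [law, sum_filter, jointPmf, Fintype.sum_prod_type, ite_and]
  have hfg : ∀ a u b, law (jointPmf p q) (fun z => (f z.1, z.2, g z.1)) (a, u, b)
      = law (fun ω => p ω * q ω u) (fun ω => (f ω, g ω)) (a, b) := by
    intro a u b
    simp only [law, sum_filter, jointPmf, Fintype.sum_prod_type, Prod.mk.injEq]
    refine sum_congr rfl fun ω _ => ?_
    by_cases h : f ω = a <;> simp [h, ite_and]
  simp only [condEntropy, Fintype.sum_prod_type, hg, hfg, sum_neg_distrib]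
  rw [sum_comm]

end Continuity

section KernelSums

lemma isCompact_convexHull {E : Type*} [NormedAddCommGroup E] [NormedSpace ℝ E]
    [FiniteDimensional ℝ E] {s : Set E} (hs : IsCompact s) : IsCompact (convexHull ℝ s) := by
  -- By Carathéodory's theorem the convex hull is a finite union of continuous images of compact
  -- sets.
  let mix (m : ℕ) (z : (Fin m → ℝ) × (Fin m → E)) : E := ∑ i, z.1 i • z.2 i
  have hmix : ∀ m, Continuous (mix m) := fun m => by fun_prop
  suffices h : convexHull ℝ s = ⋃ m ∈ Set.Iic (Module.finrank ℝ E + 1),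
      mix m '' (stdSimplex ℝ (Fin m) ×ˢ Set.univ.pi fun _ => s) by
    rw [h]
    exact (Set.finite_Iic _).isCompact_biUnion fun m _ =>
      ((isCompact_stdSimplex ℝ (Fin m)).prod (isCompact_univ_pi fun _ => hs)).image (hmix m)
  refine Set.Subset.antisymm (fun x hx => ?_) (Set.iUnion₂_subset fun m _ => ?_)
  · obtain ⟨ι, _, z, w, hz, haff, hw, hw1, rfl⟩ := eq_pos_convex_span_of_mem_convexHull hx
    set σ := (Fintype.equivFin ι).symm
    refine Set.mem_biUnion (Set.mem_Iic.2 (haff.card_le_finrank_succ.trans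
      (Nat.add_le_add_right (Submodule.finrank_le _) 1)))
      ⟨(w ∘ σ, z ∘ σ), ⟨⟨fun i => (hw _).le, (σ.sum_comp w).trans hw1⟩,
        fun i _ => hz (Set.mem_range_self _)⟩, σ.sum_comp fun i => w i • z i⟩
  · rintro _ ⟨⟨w, z⟩, ⟨hw, hz⟩, rfl⟩
    exact (convex_convexHull ℝ s).sum_mem (fun i _ => hw.1 i) hw.2
      fun i _ => subset_convexHull ℝ s (hz i (Set.mem_univ i))

variable {V E : Type*}

/-- The values of `∑ₐ Φ (q (a | ·))` over all conditional pmfs `q` from `V` to a finite alphabet. -/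
def kernelSums [AddCommMonoid E] (Φ : (V → ℝ) → E) : Set E :=
  {e | ∃ (m : ℕ) (q : V → Fin m → ℝ), (∀ v, q v ∈ stdSimplex ℝ (Fin m)) ∧
    ∑ a, Φ (fun v => q v a) = e}

lemma sum_mem_kernelSums [AddCommMonoid E] (Φ : (V → ℝ) → E) {A : Type*} [Fintype A]
    {q : V → A → ℝ} (hq : ∀ v, q v ∈ stdSimplex ℝ A) :
    ∑ a, Φ (fun v => q v a) ∈ kernelSums Φ := by
  set σ := (Fintype.equivFin A).symm
  refine ⟨Fintype.card A, fun v a => q v (σ a), fun v => ⟨fun a => (hq v).1 _, ?_⟩,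
    σ.sum_comp fun a => Φ fun v => q v a⟩
  rw [← (hq v).2]
  exact σ.sum_comp (q v)

variable [Fintype V] [Nonempty V]

lemma exists_mem_stdSimplex_smul_eq {σ : V → ℝ} (hσ : ∀ v, 0 ≤ σ v) :
    ∃ ρ ∈ stdSimplex ℝ V, (∑ v, σ v) • ρ = σ := by
  classical
  rcases eq_or_ne (∑ v, σ v) 0 with h | h
  · have hzero : σ = 0 := funext fun v => (sum_eq_zero_iff_of_nonneg fun v _ => hσ v).1 h v
      (mem_univ v)
    exact ⟨_, single_mem_stdSimplex ℝ (Classical.arbitrary V), by rw [h, zero_smul, hzero]⟩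
  · have hpos : 0 ≤ ∑ v, σ v := sum_nonneg fun v _ => hσ v
    exact ⟨(∑ v, σ v)⁻¹ • σ, ⟨fun v => mul_nonneg (inv_nonneg.2 hpos) (hσ v), by
      simp only [Pi.smul_apply, smul_eq_mul, ← mul_sum, inv_mul_cancel₀ h]⟩, smul_inv_smul₀ h σ⟩

variable [NormedAddCommGroup E] [NormedSpace ℝ E] {Φ : (V → ℝ) → E}

/-- A kernel `q` mixes the normalized vectors `q (a | ·)`, with weights the masses of the letters
`a`, and the mean of these vectors is uniform. -/
lemma mem_kernelSums_iff (hΦ : ∀ (c : ℝ) ρ, Φ (c • ρ) = c • Φ ρ) {e : E} :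
    e ∈ kernelSums Φ ↔ ((fun _ => (Fintype.card V : ℝ)⁻¹), (Fintype.card V : ℝ)⁻¹ • e)
      ∈ convexHull ℝ ((fun ρ => (ρ, Φ ρ)) '' stdSimplex ℝ V) := by
  set N : ℝ := (Fintype.card V : ℝ)
  have hN : N ≠ 0 := by positivity
  constructor
  · rintro ⟨m, q, hq, rfl⟩
    choose ρ hρ hρq using fun a => exists_mem_stdSimplex_smul_eq fun v => (hq v).1 a
    have hmass : ∑ a, N⁻¹ * ∑ v, q v a = 1 := by
      rw [← mul_sum, sum_comm]
      simp only [(hq _).2, sum_const, card_univ, nsmul_eq_mul, mul_one]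
      exact inv_mul_cancel₀ hN
    have hmix : ∑ a, (N⁻¹ * ∑ v, q v a) • (ρ a, Φ (ρ a))
        = ((fun _ => N⁻¹), N⁻¹ • ∑ a, Φ fun v => q v a) := by
      simp only [mul_smul, Prod.smul_mk, ← hΦ (∑ v, q v _), hρq, ← prod_mk_sum, ← smul_sum]
      refine Prod.ext (funext fun v => ?_) rfl
      simp [(hq v).2]
    rw [← hmix]
    exact (convex_convexHull ℝ _).sum_mem (fun a _ => mul_nonneg (by positivity)
      (sum_nonneg fun v _ => (hq v).1 a)) hmass fun a _ => subset_convexHull ℝ _ ⟨ρ a, hρ a, rfl⟩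
  · intro h
    obtain ⟨ι, _, w, x, hw, -, hx, hsum⟩ := mem_convexHull_iff_exists_fintype.1 h
    choose ρ hρ hρx using hx
    simp only [← hρx, Prod.smul_mk, ← prod_mk_sum, Prod.mk.injEq] at hsum
    obtain ⟨hmean, hvalue⟩ := hsum
    have he : e = ∑ i, Φ (fun v => N * w i * ρ i v) := by
      rw [← smul_inv_smul₀ hN e, ← hvalue, smul_sum]
      exact sum_congr rfl fun i _ => by rw [smul_smul, ← hΦ]; rfl
    rw [he]
    refine sum_mem_kernelSums Φ fun v =>
      ⟨fun i => mul_nonneg (mul_nonneg (Nat.cast_nonneg _) (hw i)) ((hρ i).1 v), ?_⟩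
    have := congrFun hmean v
    simp only [Finset.sum_apply, Pi.smul_apply, smul_eq_mul] at this
    simp only [mul_assoc, ← mul_sum, this, mul_inv_cancel₀ hN]

lemma convex_kernelSums {V : Type*} [Finite V] [Nonempty V] {Φ : (V → ℝ) → E}
    (hΦ : ∀ (c : ℝ) ρ, Φ (c • ρ) = c • Φ ρ) : Convex ℝ (kernelSums Φ) := by
  have := Fintype.ofFinite V
  intro e he e' he' a b ha hb hab
  rw [mem_kernelSums_iff hΦ] at he he' ⊢
  convert convex_convexHull ℝ _ he he' ha hb hab using 1
  refine Prod.ext (funext fun v => ?_) ?_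
  · simp [← add_mul, hab]
  · change _ = a • (_ • e) + b • (_ • e')
    module

lemma isCompact_kernelSums [FiniteDimensional ℝ E] (hΦ : ∀ (c : ℝ) ρ, Φ (c • ρ) = c • Φ ρ)
    (hcont : ContinuousOn Φ (stdSimplex ℝ V)) : IsCompact (kernelSums Φ) := by
  have hN : (Fintype.card V : ℝ)⁻¹ ≠ 0 := by positivity
  have hgraph : IsCompact ((fun ρ => (ρ, Φ ρ)) '' stdSimplex ℝ V) :=
    (isCompact_stdSimplex ℝ V).image_of_continuousOn (continuousOn_id.prodMk hcont)
  have hembed : Topology.IsClosedEmbedding fun e : E =>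
      ((fun _ : V => (Fintype.card V : ℝ)⁻¹), (Fintype.card V : ℝ)⁻¹ • e) :=
    Function.LeftInverse.isClosedEmbedding (f := fun z => (Fintype.card V : ℝ)⁻¹⁻¹ • z.2)
      (fun e => inv_smul_smul₀ hN e) (by fun_prop) (by fun_prop)
  convert hembed.isCompact_preimage (isCompact_convexHull hgraph) using 1
  exact Set.ext fun e => mem_kernelSums_iff hΦ

end KernelSums

section EntropyPair

variable {Ω X Y V W U A M : Type*} [Fintype Ω] [Fintype X] [Fintype Y] [Fintype A] [Fintype U]
  [Fintype M]

/-- The contribution of one letter `a` of an auxiliary variable `A`, observed with probabilities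
`ρ v = q (a | v)`, to the pair of conditional entropies `H(x | A, y)` and `H(ω | A, y)`. -/
def entropyPair (p : Ω → ℝ) (x : Ω → X) (y : Ω → Y) (v : Ω → V) (ρ : V → ℝ) : ℝ × ℝ :=
  (condEntropy (fun ω => p ω * ρ (v ω)) x y, condEntropy (fun ω => p ω * ρ (v ω)) id y)

lemma sum_entropyPair (p : Ω → ℝ) (x : Ω → X) (y : Ω → Y) (v : Ω → V) (q : V → A → ℝ) :
    ∑ a, entropyPair p x y v (fun b => q b a)
      = (condEntropy (jointPmf p fun ω => q (v ω)) (fun z => x z.1) (fun z => (z.2, y z.1)),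
        condEntropy (jointPmf p fun ω => q (v ω)) Prod.fst (fun z => (z.2, y z.1))) := by
  rw [condEntropy_jointPmf]
  exact (prod_mk_sum _ _ _).symm.trans
    (congrArg _ (condEntropy_jointPmf p (fun ω => q (v ω)) id y).symm)

lemma entropyPair_smul (p : Ω → ℝ) (x : Ω → X) (y : Ω → Y) (v : Ω → V) (c : ℝ) (ρ : V → ℝ) :
    entropyPair p x y v (c • ρ) = c • entropyPair p x y v ρ := by
  have hscale : (fun ω => p ω * (c • ρ) (v ω)) = c • fun ω => p ω * ρ (v ω) :=
    funext fun ω => mul_left_comm (p ω) c (ρ (v ω))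
  rw [entropyPair, hscale, condEntropy_smul, condEntropy_smul]
  rfl

lemma continuousOn_entropyPair [Fintype V] {p : Ω → ℝ} (hp : ∀ ω, 0 ≤ p ω) (x : Ω → X) (y : Ω → Y)
    (v : Ω → V) : ContinuousOn (entropyPair p x y v) (stdSimplex ℝ V) := by
  have hweight : Continuous fun (ρ : V → ℝ) ω => p ω * ρ (v ω) := by fun_prop
  have hnonneg : Set.MapsTo (fun (ρ : V → ℝ) ω => p ω * ρ (v ω)) (stdSimplex ℝ V)
      {r | ∀ ω, 0 ≤ r ω} := fun ρ hρ ω => mul_nonneg (hp ω) (hρ.1 _)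
  exact ((continuousOn_condEntropy x y).comp hweight.continuousOn hnonneg).prodMk
    ((continuousOn_condEntropy id y).comp hweight.continuousOn hnonneg)

variable [Fintype W]

lemma condEntropy_le_of_code {p : Ω → ℝ} (hp : p ∈ stdSimplex ℝ Ω) (x : Ω → X) (y : Ω → Y)
    (v : Ω → V) {t : W → U → ℝ} (ht : ∀ w, t w ∈ stdSimplex ℝ U) {n l : ℕ} [NeZero l]
    (enc : (Fin n → X) → Fin l → W) (helper : (Fin n → V) → M)
    (dec : (Fin l → U) → (Fin n → Y) → M → Fin n → X) :
    condEntropy (iid n p) (fun s i => x (s i))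
        (fun s => (helper fun i => v (s i), fun i => y (s i)))
      ≤ 1 + codeError (iid n p) (fun s i => x (s i)) (fun s i => y (s i)) (fun s i => v (s i))
          (fun w => piPmf fun i => t (w i)) enc helper dec * (n * logb 2 (Fintype.card X))
        + l * mutualInfo (jointPmf (averageInput (iid n p) fun s => enc fun i => x (s i)) t)
            Prod.fst Prod.snd := by
  classical
  have hiid : iid n p ∈ stdSimplex ℝ (Fin n → Ω) := piPmf_mem_stdSimplex fun _ => hp
  have hchannel := condEntropy_le_condEntropy_add_card_mul_mutualInfo hiid
    (fun s => enc fun i => x (s i)) ht (fun s i => x (s i))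
    fun s => (helper fun i => v (s i), fun i => y (s i))
  have hfano := condEntropy_le_of_decoder (jointPmf_mem_stdSimplex hiid fun s =>
    piPmf_mem_stdSimplex fun i => ht (enc (fun j => x (s j)) i)) (fun z i => x (z.1 i))
    (fun z => (z.2, helper fun i => v (z.1 i), fun i => y (z.1 i)))
    fun g => dec g.1 g.2.2 g.2.1
  rw [Fintype.card_pi_const, Nat.cast_pow, logb_pow] at hfano
  rw [Fintype.card_fin] at hchannel
  exact hchannel.trans (add_le_add_left hfano _)

lemma exists_mem_kernelSums_of_code [Finite V] {p : Ω → ℝ} (hp : p ∈ stdSimplex ℝ Ω) (x : Ω → X)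
    (y : Ω → Y) (v : Ω → V) {t : W → U → ℝ} (ht : ∀ w, t w ∈ stdSimplex ℝ U) {n l : ℕ}
    (hn : 0 < n) (hl : 0 < l) (enc : (Fin n → X) → Fin l → W) (helper : (Fin n → V) → M)
    (dec : (Fin l → U) → (Fin n → Y) → M → Fin n → X) :
    ∃ z ∈ kernelSums (entropyPair p x y v),
      n * z.1 ≤ 1 + codeError (iid n p) (fun s i => x (s i)) (fun s i => y (s i))
          (fun s i => v (s i)) (fun w => piPmf fun i => t (w i)) enc helper dec
            * (n * logb 2 (Fintype.card X))
        + l * mutualInfo (jointPmf (averageInput (iid n p) fun s => enc fun i => x (s i)) t)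
            Prod.fst Prod.snd ∧
      n * condEntropy p id y - logb 2 (Fintype.card M) ≤ n * z.2 := by
  classical
  obtain ⟨ω⟩ := nonempty_of_mem_stdSimplex hp
  have : Fintype V := Fintype.ofFinite V
  have hV : Nonempty V := ⟨v ω⟩
  have : NeZero l := ⟨hl.ne'⟩
  have hn0 : (n : ℝ) ≠ 0 := by positivity
  set e : Fin n → ℝ × ℝ := fun i =>
    ∑ a, entropyPair p x y v fun b => auxKernel p y v helper i b a
  have hfst : ∑ i, (e i).1 = ∑ i, condEntropy (jointPmf p fun ω => auxKernel p y v helper i (v ω))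
      (fun z => x z.1) (fun z => (z.2, y z.1)) := by simp only [e, sum_entropyPair]
  have hsnd : ∑ i, (e i).2 = ∑ i, condEntropy (jointPmf p fun ω => auxKernel p y v helper i (v ω))
      Prod.fst (fun z => (z.2, y z.1)) := by simp only [e, sum_entropyPair]
  refine ⟨∑ i, (n : ℝ)⁻¹ • e i, (convex_kernelSums (entropyPair_smul p x y v)).sum_mem
    (fun _ _ => by positivity) (by simp [hn0])
    fun i _ => sum_mem_kernelSums _ (auxKernel_mem_stdSimplex y v helper hp i), ?_, ?_⟩
  · rw [← smul_sum, Prod.smul_fst, smul_eq_mul, mul_inv_cancel_left₀ hn0, Prod.fst_sum, hfst]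
    exact (sum_condEntropy_auxKernel_le y v helper hp x).trans
      (condEntropy_le_of_code hp x y v ht enc helper dec)
  · rw [← smul_sum, Prod.smul_snd, smul_eq_mul, mul_inv_cancel_left₀ hn0, Prod.snd_sum, hsnd]
    exact mul_condEntropy_sub_logb_card_le y v helper hp

end EntropyPair

section Limit

lemma exists_forall_nonpos_of_isCompact {E ι : Type*} [TopologicalSpace E]
    [FirstCountableTopology E] {s : Set E} (hs : IsCompact s) {f : ι → E → ℝ}
    (hf : ∀ k, ContinuousOn (f k) s) (h : ∀ ε > 0, ∃ e ∈ s, ∀ k, f k e ≤ ε) :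
    ∃ e ∈ s, ∀ k, f k e ≤ 0 := by
  choose e he hfe using fun n : ℕ => h (1 / (n + 1)) (by positivity)
  obtain ⟨a, ha, φ, hφ, hlim⟩ := hs.tendsto_subseq he
  refine ⟨a, ha, fun k => ?_⟩
  have hfa : Tendsto (fun n => f k (e (φ n))) atTop (nhds (f k a)) :=
    (hf k a ha).tendsto.comp (tendsto_nhdsWithin_iff.2 ⟨hlim, .of_forall fun n => he (φ n)⟩)
  exact le_of_tendsto_of_tendsto' hfa
    (tendsto_one_div_add_atTop_nhds_zero_nat.comp hφ.tendsto_atTop) fun n => hfe (φ n) k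

end Limit

section Converse

variable {K : ℕ} {X W : Type*} {Y V U : Fin K → Type*} [Fintype X] [∀ k, Fintype (Y k)]
  [∀ k, Fintype (V k)] {P : Letter X Y V → ℝ}

lemma logb_numMessages_le {n : ℕ} {r : ℝ} (h : 0 < numMessages n r) :
    logb 2 (numMessages n r) ≤ n * r := by
  rw [logb_le_iff_le_rpow one_lt_two (Nat.cast_pos.2 h)]
  exact Nat.floor_le (by positivity)

/-- The joint pmf of the source letter and of auxiliary variables `A₁, …, A_K` that are drawn
independently from `V₁, …, V_K` by means of the kernels `q`. -/
def auxJoint (P : Letter X Y V → ℝ) {m : Fin K → ℕ} (q : ∀ k, V k → Fin (m k) → ℝ) :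
    Letter X Y V × (∀ k, Fin (m k)) → ℝ :=
  jointPmf P fun ω => piPmf fun k => q k (ω.2.2 k)

variable {m : Fin K → ℕ} {q : ∀ k, V k → Fin (m k) → ℝ}

lemma law_auxJoint (hq : ∀ k v, q k v ∈ stdSimplex ℝ (Fin (m k))) (k : Fin K) :
    law (auxJoint P q) (fun z => (z.1, z.2 k)) = jointPmf P fun ω => q k (ω.2.2 k) := by
  rw [auxJoint, law_jointPmf_map_snd P _ fun a : ∀ k, Fin (m k) => a k]
  simp only [law_piPmf_apply fun k => hq k _]

lemma isAuxiliary_auxJoint (hP : P ∈ stdSimplex ℝ (Letter X Y V))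
    (hq : ∀ k v, q k v ∈ stdSimplex ℝ (Fin (m k))) : IsAuxiliary P m (auxJoint P q) := by
  have hpi : ∀ ω : Letter X Y V, piPmf (fun k => q k (ω.2.2 k)) ∈ stdSimplex ℝ (∀ k, Fin (m k)) :=
    fun ω => piPmf_mem_stdSimplex fun k => hq k _
  refine ⟨jointPmf_mem_stdSimplex hP hpi, law_jointPmf_fst P hpi, fun k => ?_⟩
  have h := isMarkovChain_jointPmf P (fun ω => (ω.1, ω.2.1 k)) (fun ω => ω.2.2 k) (hq k)
  simp only [← law_auxJoint hq k, IsMarkovChain, law_law] at h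
  exact h

lemma equivocation_auxJoint (hq : ∀ k v, q k v ∈ stdSimplex ℝ (Fin (m k))) (k : Fin K) :
    equivocation m (auxJoint P q) k
      = condEntropy (jointPmf P fun ω => q k (ω.2.2 k)) (fun z => z.1.1)
          (fun z => (z.2, z.1.2.1 k)) := by
  rw [← law_auxJoint hq k, ← condEntropy_comp]
  rfl

lemma helperInfo_auxJoint_le (hP : P ∈ stdSimplex ℝ (Letter X Y V))
    (hq : ∀ k v, q k v ∈ stdSimplex ℝ (Fin (m k))) (k : Fin K) :
    helperInfo m (auxJoint P q) k ≤ condEntropy P id (fun ω => ω.2.1 k)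
      - condEntropy (jointPmf P fun ω => q k (ω.2.2 k)) Prod.fst
          (fun z => (z.2, z.1.2.1 k)) := by
  have hJ := jointPmf_mem_stdSimplex hP fun ω => hq k (ω.2.2 k)
  have hsource := condEntropy_comp (jointPmf P fun ω => q k (ω.2.2 k)) Prod.fst id
    fun ω : Letter X Y V => ω.2.1 k
  rw [law_jointPmf_fst P fun ω => hq k (ω.2.2 k)] at hsource
  calc helperInfo m (auxJoint P q) k
      = condMutualInfo (jointPmf P fun ω => q k (ω.2.2 k)) (fun z => z.1.2.2 k) Prod.snd
          (fun z => z.1.2.1 k) := by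
        rw [← law_auxJoint hq k, ← condMutualInfo_comp]
        rfl
    _ ≤ condMutualInfo (jointPmf P fun ω => q k (ω.2.2 k)) Prod.fst Prod.snd
          (fun z => z.1.2.1 k) := condMutualInfo_comp_left_le hJ.1 Prod.fst (fun ω => ω.2.2 k) _ _
    _ = _ := by
        rw [condMutualInfo_eq_sub hJ.1, ← hsource]
        rfl

variable [Fintype W] [∀ k, Fintype (U k)] {T : W → (∀ k, U k) → ℝ}

/-- By how much the pair `z = (H(X | A, Y), H(X, Y₁, …, V_K | A, Y))` of receiver `k` violates the
two inequalities of the theorem, when the channel input has pmf `PW`. -/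
def converseExcess (P : Letter X Y V → ℝ) (T : W → (∀ k, U k) → ℝ) (κ : ℝ) (R : Fin K → ℝ)
    (k : Fin K) (PW : W → ℝ) (z : ℝ × ℝ) : ℝ :=
  max (z.1 - κ * channelInfo PW T k) (condEntropy P id (fun ω => ω.2.1 k) - R k - z.2)

lemma continuousOn_converseExcess (hT : ∀ w u, 0 ≤ T w u) (κ : ℝ) (R : Fin K → ℝ) (k : Fin K) :
    ContinuousOn (fun e : (W → ℝ) × (Fin K → ℝ × ℝ) => converseExcess P T κ R k e.1 (e.2 k))
      {e | ∀ w, 0 ≤ e.1 w} := by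
  have hjoint : Continuous fun e : (W → ℝ) × (Fin K → ℝ × ℝ) => channelJoint e.1 T :=
    continuous_pi fun z => by unfold channelJoint; fun_prop
  have hinfo := (continuousOn_mutualInfo (fun z : W × (∀ k, U k) => z.1) fun z => z.2 k).comp
    hjoint.continuousOn fun e (he : ∀ w, 0 ≤ e.1 w) z => mul_nonneg (he z.1) (hT z.1 z.2)
  exact ContinuousOn.sup (ContinuousOn.sub (by fun_prop) (hinfo.const_smul κ)) (by fun_prop)

lemma exists_converseExcess_le (hP : P ∈ stdSimplex ℝ (Letter X Y V))
    (hT : ∀ w, T w ∈ stdSimplex ℝ (∀ k, U k)) {κ : ℝ} {R : Fin K → ℝ} {n l : ℕ} (hn : 0 < n)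
    (hl : 0 < l) (hκ : (l : ℝ) = κ * n) (c : Code X W Y V U n l R) {δ : ℝ} (hδ : 1 / n ≤ δ)
    (hc : ∀ k, c.errorProb P T k ≤ δ) :
    ∃ PW ∈ stdSimplex ℝ W, ∀ k,
      ∃ z ∈ kernelSums (entropyPair P Prod.fst (fun ω => ω.2.1 k) fun ω => ω.2.2 k),
        converseExcess P T κ R k PW z ≤ δ * (1 + logb 2 (Fintype.card X)) := by
  have : NeZero l := ⟨hl.ne'⟩
  have hn0 : (0 : ℝ) < n := Nat.cast_pos.2 hn
  have hX : 0 ≤ logb 2 (Fintype.card X : ℝ) :=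
    div_nonneg (log_natCast_nonneg _) (log_nonneg one_le_two)
  refine ⟨averageInput (iid n P) fun s => c.enc fun i => (s i).1,
    averageInput_mem_stdSimplex (piPmf_mem_stdSimplex fun _ => hP) _, fun k => ?_⟩
  obtain ⟨z, hz, hz₁, hz₂⟩ := exists_mem_kernelSums_of_code hP Prod.fst (fun ω => ω.2.1 k)
    (fun ω => ω.2.2 k) (receiverChannel_mem_stdSimplex hT k) hn hl c.enc (c.helper k) (c.dec k)
  rw [← Code.errorProb_eq_codeError, ← channelInfo_eq, hκ] at hz₁
  rw [Fintype.card_fin] at hz₂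
  obtain ⟨ω⟩ := nonempty_of_mem_stdSimplex hP
  have hmessages := logb_numMessages_le (c.helper k fun _ => ω.2.2 k).pos
  have hδn : 1 ≤ δ * n := (div_le_iff₀ hn0).1 hδ
  have herror := mul_le_mul_of_nonneg_right (hc k) (mul_nonneg hn0.le hX)
  refine ⟨z, hz, max_le (le_of_mul_le_mul_left ?_ hn0) (le_of_mul_le_mul_left ?_ hn0)⟩
  · linarith
  · have : 0 ≤ n * (δ * (1 + logb 2 (Fintype.card X : ℝ))) := by
      have : 0 ≤ δ := (by positivity : (0 : ℝ) ≤ 1 / n).trans hδ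
      positivity
    linarith

lemma exists_forall_converseExcess_le (hP : P ∈ stdSimplex ℝ (Letter X Y V))
    (hT : ∀ w, T w ∈ stdSimplex ℝ (∀ k, U k)) {κ : ℚ} {R : Fin K → ℝ}
    (h : AchievableInfinitelyOften P T κ R) {ε : ℝ} (hε : 0 < ε) :
    ∃ PW ∈ stdSimplex ℝ W, ∀ k,
      ∃ z ∈ kernelSums (entropyPair P Prod.fst (fun ω => ω.2.1 k) fun ω => ω.2.2 k),
        converseExcess P T κ R k PW z ≤ ε := by
  set B := 1 + logb 2 (Fintype.card X : ℝ)
  have hB : 0 < B :=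
    add_pos_of_pos_of_nonneg one_pos (div_nonneg (log_natCast_nonneg _) (log_nonneg one_le_two))
  obtain ⟨N, hN⟩ := exists_nat_one_div_lt (div_pos hε hB)
  obtain ⟨n, l, hNn, hNl, hκ, c, hc⟩ := h (ε / B) (div_pos hε hB) (N + 1)
  have hn : 0 < n := by omega
  have hratio : (l : ℝ) = κ * n := by
    exact_mod_cast (div_eq_iff (Nat.cast_ne_zero.2 hn.ne')).1 hκ
  have hδ : 1 / (n : ℝ) ≤ ε / B :=
    (one_div_le_one_div_of_le (by positivity) (by exact_mod_cast hNn)).trans hN.le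
  simpa only [B, div_mul_cancel₀ ε hB.ne'] using
    exists_converseExcess_le hP hT hn (by omega) hratio c hδ hc

theorem exists_isAuxiliary_of_achievableInfinitelyOften (hP : P ∈ stdSimplex ℝ (Letter X Y V))
    (hT : ∀ w, T w ∈ stdSimplex ℝ (∀ k, U k)) {κ : ℚ} {R : Fin K → ℝ}
    (h : AchievableInfinitelyOften P T κ R) :
    ∃ PW ∈ stdSimplex ℝ W, ∃ (m : Fin K → ℕ) (Q : Letter X Y V × (∀ k, Fin (m k)) → ℝ),
      IsAuxiliary P m Q ∧
        ∀ k, helperInfo m Q k ≤ R k ∧ equivocation m Q k ≤ κ * channelInfo PW T k := by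
  obtain ⟨ω⟩ := nonempty_of_mem_stdSimplex hP
  have hV : ∀ k, Nonempty (V k) := fun k => ⟨ω.2.2 k⟩
  set region : Fin K → Set (ℝ × ℝ) := fun k =>
    kernelSums (entropyPair P Prod.fst (fun ω => ω.2.1 k) fun ω => ω.2.2 k)
  have hregion : ∀ k, IsCompact (region k) := fun k =>
    isCompact_kernelSums (entropyPair_smul _ _ _ _) (continuousOn_entropyPair hP.1 _ _ _)
  obtain ⟨⟨PW, z⟩, ⟨hPW, hz⟩, hexcess⟩ := exists_forall_nonpos_of_isCompact
    ((isCompact_stdSimplex ℝ W).prod (isCompact_univ_pi hregion))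
    (fun k => (continuousOn_converseExcess (P := P) (fun w => (hT w).1) κ R k).mono
      fun e he => he.1.1) fun ε hε => by
      obtain ⟨PW, hPW, hz⟩ := exists_forall_converseExcess_le hP hT h hε
      choose z hz hexcess using hz
      exact ⟨(PW, z), ⟨hPW, fun k _ => hz k⟩, hexcess⟩
  choose m q hq hqz using fun k => hz k (Set.mem_univ k)
  refine ⟨PW, hPW, m, auxJoint P q, isAuxiliary_auxJoint hP hq, fun k => ?_⟩
  have hzk := (sum_entropyPair P Prod.fst (fun ω => ω.2.1 k) (fun ω => ω.2.2 k) (q k)).symm.trans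
    (hqz k)
  have hhelper := helperInfo_auxJoint_le hP hq k
  have hequivocation := equivocation_auxJoint (P := P) hq k
  obtain ⟨h₁, h₂⟩ := max_le_iff.1 (hexcess k)
  rw [← hzk] at h₁ h₂
  exact ⟨by linarith, by linarith⟩

end Converse

end BSCoop

end

theorem theorem2 {K : ℕ} {X W : Type*} {Y V U : Fin K → Type*}
    [Fintype X] [Fintype W] [∀ k, Fintype (Y k)] [∀ k, Fintype (V k)] [∀ k, Fintype (U k)]
    (P : BSCoop.Letter X Y V → ℝ) (hP : P ∈ stdSimplex ℝ (BSCoop.Letter X Y V))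
    (T : W → (∀ k, U k) → ℝ) (hT : ∀ w, T w ∈ stdSimplex ℝ (∀ k, U k))
    (κ : ℚ) (hκ : 0 < κ) (R : Fin K → ℝ) :
    -- achievability
    ((∃ PW ∈ stdSimplex ℝ W, ∃ (m : Fin K → ℕ) (Q : BSCoop.Letter X Y V × (∀ k, Fin (m k)) → ℝ),
        BSCoop.IsAuxiliary P m Q ∧
        ∀ k, BSCoop.helperInfo m Q k < R k ∧
          BSCoop.equivocation m Q k < κ * BSCoop.channelInfo PW T k) →
      BSCoop.Achievable P T κ R) ∧
    -- converse
    (BSCoop.Achievable P T κ R →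
      ∃ PW ∈ stdSimplex ℝ W, ∃ (m : Fin K → ℕ) (Q : BSCoop.Letter X Y V × (∀ k, Fin (m k)) → ℝ),
        BSCoop.IsAuxiliary P m Q ∧
        ∀ k, BSCoop.helperInfo m Q k ≤ R k ∧
          BSCoop.equivocation m Q k ≤ κ * BSCoop.channelInfo PW T k) ∧
    -- converse, for codes that exist only at arbitrarily large blocklengths
    (BSCoop.AchievableInfinitelyOften P T κ R →
      ∃ PW ∈ stdSimplex ℝ W, ∃ (m : Fin K → ℕ) (Q : BSCoop.Letter X Y V × (∀ k, Fin (m k)) → ℝ),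
        BSCoop.IsAuxiliary P m Q ∧
        ∀ k, BSCoop.helperInfo m Q k ≤ R k ∧
          BSCoop.equivocation m Q k ≤ κ * BSCoop.channelInfo PW T k) := by
  refine ⟨?_, fun h => BSCoop.exists_isAuxiliary_of_achievableInfinitelyOften hP hT
    (BSCoop.achievableInfinitelyOften_of_achievable hκ h),
    BSCoop.exists_isAuxiliary_of_achievableInfinitelyOften hP hT⟩
  rintro ⟨PW, hPW, m, Q, hQ, h⟩
  exact BSCoop.achievable_of_isAuxiliary hT hκ hPW hQ h
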